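/- **Theorem (Analyticity of blow-up times).** *Setting.* Let $\alpha_1,\dots,\alpha_n,k\ge 1$ be integers. Let $f:\mathbb{R}^n\to\mathbb{R}^n$ be a smooth vector field that is asymptotically quasi-homogeneous of type $\alpha$ and order $k+1$ at infinity: there is a smooth $f_{\alpha,k}$ with $(f_{\alpha,k})_j(s^{\alpha_1}x_1,\dots,s^{\alpha_n}x_n)=s^{k+\alpha_j}(f_{\alpha,k})_j(x)$ for all $x\in\mathbb{R}^n$, $s\in\mathbb{R}$, such that $s^{-(k+\alpha_j)}f_j(s^{\alpha_1}x_1,\dots,s^{\alpha_n}x_n)-(f_{\alpha,k})_j(x)\to 0$ as $s\to+\infty$, uniformly on the unit sphere, for each $j$. For $y_0\in\mathbb{R}^n$ let $t_{\max}(y_0)\in(0,\infty]$ be the maximal existence time of the solution of $y'=f(y)$, $y(0)=y_0$. *Compactifications.* Let $T$ (defined on an open set $\mathrm{dom}\,T$, with image $\mathcal D$, horizon $\mathcal E$, time factor $S$ and desingularized vector field $g$) be one of the following. In (b) and (c), $c\ge 1$ and $\beta_j$ are integers with $\alpha_j\beta_j=c$ for all $j$, $p(x)=\bigl(\sum_j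 x_j^{2\beta_j}\bigr)^{1/2c}$, $\mathrm{dom}\,T=\mathbb{R}^n$, $\mathcal D=\{p<1\}$, $\mathcal E=\{p=1\}$, $T(y)_j=y_j/\kappa(y)^{\alpha_j}$, and $\tilde f_j(x)=\kappa^{-(k+\alpha_j)}f_j(\kappa^{\alpha_1}x_1,\dots,\kappa^{\alpha_n}x_n)$ with $\kappa=\kappa(T^{-1}(x))$. (a) *Directional*, for an index $i$ and a sign $\sigma=\pm1$: $\mathrm{dom}\,T=\{\sigma y_i>0\}$, and $T(y)=(s,(\hat x_j)_{j\ne i})$ is given by $y_i=\sigma s^{-\alpha_i}$, $s>0$, and $y_j=\hat x_j s^{-\alpha_j}$ for $j\neq i$; $\mathcal D=\{s>0\}$, $\mathcal E=\{s=0\}$, $S=s^k$. With $\hat f_j=s^{k+\alpha_j}f_j(T^{-1}(s,\hat x))$, the field $g$ is $\frac{ds}{d\tau}=-\sigma s\hat f_i/\alpha_i$, $\frac{d\hat x_j}{d\tau}=\hat f_j-\sigma\frac{\alpha_j}{\alpha_i}\hat x_j\hat f_i$. (b) *Poincaré type*, with $k/2c\in\mathbb{N}$: $\kappa(y)=(1+p(y)^{2c})^{1/2c}$,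 $S=(1-p(x)^{2c})^{k/2c}$, $g_i=\tilde f_i-\alpha_ix_i\sum_j\frac{x_j^{2\beta_j-1}}{\alpha_j}\tilde f_j$. (c) *Parabolic type*: $\kappa(y)\ge 1$ is the root of $\kappa^{2c}-\kappa^{2c-1}=p(y)^{2c}$; with $w=1-\frac{2c-1}{2c}(1-p(x)^{2c})$, $S=w\,(1-p(x)^{2c})^k$ and $g_i=w\,\tilde f_i-\alpha_ix_i\sum_j\frac{x_j^{2\beta_j-1}}{\alpha_j}\tilde f_j$. *Assumptions.* The field $g$ on $\mathcal D$ is the restriction of a polynomial vector field on $\mathbb{R}^n$, also denoted $g$. The point $p_*\in\mathcal E$ is an equilibrium of $g$ for which the eigenvalues of $Dg(p_*)$ are real, nonzero and distinct. The negative ones, $\lambda_1,\dots,\lambda_m$, with eigenvectors $\xi_1,\dots,\xi_m$, are non-resonant: $\sum_i\gamma_i\lambda_i\ne\lambda_j$ for all $j$ and all $\gamma\in\mathbb{Z}_{\ge0}^m$ with $|\gamma|\ge2$. Let $\Lambda=\mathrm{diag}(\lambda_1,\dots,\lambda_m)$ and let $B=\{\theta\in\mathbb{R}^m:|\theta_i|\le1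 \text{ for all } i\}$. Let $P(\theta)=\sum_\gamma a_\gamma\theta^\gamma$, $a_\gamma\in\mathbb{R}^n$, be a power series that converges absolutely on the closed unit polydisc, with $P(0)=p_*$, $DP(0)=[\xi_1|\cdots|\xi_m]$, and such that for every $\theta\in B$ the curve $\tau\mapsto P(e^{\Lambda\tau}\theta)$, $\tau\ge0$, solves $\dot x=g(x)$. Put $W=P(B)$ (a local stable manifold of $p_*$) and $V=T^{-1}(W)=\{y\in\mathrm{dom}\,T: T(y)\in W\}$. *Conclusions.* 1. For every $y_0\in V$, with $T(y_0)=P(\theta)$, $\theta\in B$, one has $0<t_{\max}(y_0)<\infty$ and $t_{\max}(y_0)=\int_0^\infty S\bigl(P(e^{\Lambda\tau}\theta)\bigr)\,d\tau$, with an absolutely convergent integral. 2. The blow-up time is real analytic on the interior of $V$. That is: (i) at every $y_0\in\mathrm{dom}\,T$ with $T(y_0)=P(\theta)$ for some $\theta$ with $|\theta_i|<1$ for all $i$, the function $t_{\max}|_V$ coincides near $y_0$ with a function that is real analytic in a neighbourhood of $y_0$ in $\mathbb{R}^n$; and (ii) $t_{\max}$ itself is real analytic at every point of the topological interior of $V$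 in $\mathbb{R}^n$. 3. For every $y_0\in V$ the solution $y(t)$, $0\le t<t_{\max}(y_0)$, with $y(0)=y_0$ stays in $V$, and as $t\to t_{\max}(y_0)$ one has $|y(t)|\to\infty$ and $t_{\max}(y(t))\to0$. -/

import Mathlib

open Set Filter Topology MeasureTheory
open scoped ContDiff ENNReal

noncomputable section

namespace BlowUp

/-! ### The original system and its maximal existence time -/

/-- `y` is a solution of `y' = f(y)` on `[0, T)`. -/
def IsSolutionOn {n : ℕ} (f : (Fin n → ℝ) → (Fin n → ℝ)) (y : ℝ → Fin n → ℝ) (T : ℝ) : Prop :=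
  ∀ t ∈ Ico (0 : ℝ) T, HasDerivWithinAt y (f (y t)) (Ico 0 T) t

/-- The maximal existence time `t_max(y₀)` of `y' = f(y)`, `y(0) = y₀`, as an extended
nonnegative number: the supremum of all `T` such that a solution exists on `[0, T)`. -/
def tmax {n : ℕ} (f : (Fin n → ℝ) → (Fin n → ℝ)) (y₀ : Fin n → ℝ) : ℝ≥0∞ :=
  sSup {t : ℝ≥0∞ | ∃ T : ℝ, t = ENNReal.ofReal T ∧
    ∃ y : ℝ → Fin n → ℝ, y 0 = y₀ ∧ IsSolutionOn f y T}

/-! ### Asymptotic quasi-homogeneity -/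

/-- The weighted dilation `(s^{α₁} x₁, …, s^{αₙ} xₙ)`. -/
def dil {n : ℕ} (α : Fin n → ℕ) (s : ℝ) (x : Fin n → ℝ) : Fin n → ℝ :=
  fun j => s ^ α j * x j

/-- A smooth function that is quasi-homogeneous of type `α` and order `k`. -/
def IsQuasiHomogeneousFun {n : ℕ} (α : Fin n → ℕ) (k : ℕ) (f : (Fin n → ℝ) → ℝ) : Prop :=
  ContDiff ℝ ∞ f ∧ ∀ (x : Fin n → ℝ) (s : ℝ), f (dil α s x) = s ^ k * f x

/-- A smooth vector field that is quasi-homogeneous of type `α` and order `k + 1`. -/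
def IsQuasiHomogeneous {n : ℕ} (α : Fin n → ℕ) (k : ℕ)
    (f : (Fin n → ℝ) → (Fin n → ℝ)) : Prop :=
  ∀ j, IsQuasiHomogeneousFun α (k + α j) (fun x => f x j)

/-- A smooth vector field that is asymptotically quasi-homogeneous of type `α` and order `k + 1`
at infinity; the limit is uniform on the Euclidean unit sphere. -/
def IsAsympQuasiHomogeneous {n : ℕ} (α : Fin n → ℕ) (k : ℕ)
    (f : (Fin n → ℝ) → (Fin n → ℝ)) : Prop :=
  ContDiff ℝ ∞ f ∧
  ∃ fα : (Fin n → ℝ) → (Fin n → ℝ), IsQuasiHomogeneous α k fα ∧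
    ∀ j, TendstoUniformlyOn
      (fun (s : ℝ) (x : Fin n → ℝ) =>
        (f (dil α s x) j - s ^ (k + α j) * fα x j) / s ^ (k + α j))
      (fun _ => 0) atTop {x : Fin n → ℝ | ∑ i, x i ^ 2 = 1}

/-! ### Compactifications -/

/-- `p(y) = (∑ y_i^{2β_i})^{1/(2c)}`. -/
def pnorm {n : ℕ} (β : Fin n → ℕ) (c : ℕ) (y : Fin n → ℝ) : ℝ :=
  (∑ i, y i ^ (2 * β i)) ^ ((1 : ℝ) / (2 * c))

/-- The function `q(R)` of the parabolic-type compactification: the root `κ ≥ 1` of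
`κ^{2c} - κ^{2c-1} = R^{2c}` (unique, see `kappaRoot_spec` and `kappaRoot_unique`). -/
def kappaRoot (c : ℕ) (R : ℝ) : ℝ :=
  sInf {κ : ℝ | 1 ≤ κ ∧ κ ^ (2 * c) - κ ^ (2 * c - 1) = R ^ (2 * c)}

theorem kappaRoot_inj {c : ℕ} (hc : 1 ≤ c) {κ₁ κ₂ : ℝ} (h₁ : 1 ≤ κ₁) (h₂ : 1 ≤ κ₂)
    (h : κ₁ ^ (2 * c) - κ₁ ^ (2 * c - 1) = κ₂ ^ (2 * c) - κ₂ ^ (2 * c - 1)) : κ₁ = κ₂ := by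
  obtain ⟨d, hd⟩ : ∃ d, 2 * c = d + 1 := ⟨2 * c - 1, by omega⟩
  have hd' : 2 * c - 1 = d := by omega
  rw [hd', hd] at h
  have key : ∀ a b : ℝ, 1 ≤ a → a < b → a ^ (d + 1) - a ^ d < b ^ (d + 1) - b ^ d := by
    intro a b ha hab
    have h1 : a ^ d ≤ b ^ d := pow_le_pow_left₀ (by linarith) hab.le d
    have h2 : (0 : ℝ) < b ^ d := pow_pos (by linarith) d
    have h3 : a ^ d * (a - 1) ≤ b ^ d * (a - 1) := mul_le_mul_of_nonneg_right h1 (by linarith)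
    have h4 : b ^ d * (a - 1) < b ^ d * (b - 1) := mul_lt_mul_of_pos_left (by linarith) h2
    have e1 : a ^ (d + 1) - a ^ d = a ^ d * (a - 1) := by ring
    have e2 : b ^ (d + 1) - b ^ d = b ^ d * (b - 1) := by ring
    rw [e1, e2]
    exact lt_of_le_of_lt h3 h4
  rcases lt_trichotomy κ₁ κ₂ with hlt | heq | hgt
  · exact absurd h (key _ _ h₁ hlt).ne
  · exact heq
  · exact absurd h (key _ _ h₂ hgt).ne'

theorem kappaRoot_exists {c : ℕ} (hc : 1 ≤ c) (R : ℝ) :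
    ∃ κ : ℝ, 1 ≤ κ ∧ κ ^ (2 * c) - κ ^ (2 * c - 1) = R ^ (2 * c) := by
  obtain ⟨d, hd⟩ : ∃ d, 2 * c = d + 1 := ⟨2 * c - 1, by omega⟩
  have hd' : 2 * c - 1 = d := by omega
  have hR : 0 ≤ R ^ (2 * c) := by rw [pow_mul]; positivity
  set A := R ^ (2 * c) with hA
  rw [hd', hd]
  have hcont : ContinuousOn (fun κ : ℝ => κ ^ (d + 1) - κ ^ d) (Icc 1 (1 + A)) := by fun_prop
  have hmem : A ∈ Icc ((1 : ℝ) ^ (d + 1) - 1 ^ d) ((1 + A) ^ (d + 1) - (1 + A) ^ d) := by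
    constructor
    · simpa using hR
    · have e : (1 + A) ^ (d + 1) - (1 + A) ^ d = (1 + A) ^ d * A := by ring
      rw [e]
      have : (1 : ℝ) ≤ (1 + A) ^ d := one_le_pow₀ (by linarith)
      nlinarith
  obtain ⟨κ, hκ, hκ'⟩ := intermediate_value_Icc (by linarith) hcont hmem
  exact ⟨κ, hκ.1, hκ'⟩

theorem kappaRoot_unique {c : ℕ} (hc : 1 ≤ c) {R κ : ℝ} (h₁ : 1 ≤ κ)
    (h₂ : κ ^ (2 * c) - κ ^ (2 * c - 1) = R ^ (2 * c)) : kappaRoot c R = κ := by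
  have : {κ : ℝ | 1 ≤ κ ∧ κ ^ (2 * c) - κ ^ (2 * c - 1) = R ^ (2 * c)} = {κ} := by
    ext κ'
    constructor
    · rintro ⟨h, h'⟩
      exact kappaRoot_inj hc h h₁ (h'.trans h₂.symm)
    · rintro rfl
      exact ⟨h₁, h₂⟩
  rw [kappaRoot, this, csInf_singleton]

theorem kappaRoot_spec {c : ℕ} (hc : 1 ≤ c) (R : ℝ) :
    1 ≤ kappaRoot c R ∧
      kappaRoot c R ^ (2 * c) - kappaRoot c R ^ (2 * c - 1) = R ^ (2 * c) := by
  obtain ⟨κ, h₁, h₂⟩ := kappaRoot_exists hc R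
  rw [kappaRoot_unique hc h₁ h₂]
  exact ⟨h₁, h₂⟩

/-- The three kinds of compactification: the directional one in the direction `σ e_i`
(`σ = ±1`), the Poincaré-type one and the parabolic-type one (with exponents `β`, `c`).

A point of the directional chart, `(s, x̂_j (j ≠ i))`, is stored as a vector `z` with `z i = s`
and `z j = x̂_j` for `j ≠ i`. -/
inductive Compactification (n : ℕ) : Type
  | directional (i : Fin n) (σ : ℤˣ) : Compactification n
  | poincare (β : Fin n → ℕ) (c : ℕ) : Compactification n
  | parabolic (β : Fin n → ℕ) (c : ℕ) : Compactification n

namespace Compactification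

/-- The arithmetic conditions: `α_j β_j = c` for all `j` in the global cases, and moreover
`k / 2c ∈ ℕ` for the Poincaré type. -/
def Admissible {n : ℕ} (α : Fin n → ℕ) (k : ℕ) : Compactification n → Prop
  | directional _ _ => True
  | poincare β c => 1 ≤ c ∧ (∀ j, α j * β j = c) ∧ 2 * c ∣ k
  | parabolic β c => 1 ≤ c ∧ ∀ j, α j * β j = c

/-- The part of `ℝⁿ` on which the compactification `T` is defined. -/
def source {n : ℕ} : Compactification n → Set (Fin n → ℝ)
  | directional i σ => {y | 0 < ((σ : ℤ) : ℝ) * y i}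
  | poincare _ _ => univ
  | parabolic _ _ => univ

/-- The compactification `T`. -/
def T {n : ℕ} (α : Fin n → ℕ) : Compactification n → (Fin n → ℝ) → (Fin n → ℝ)
  | directional i σ => fun y j =>
      let s : ℝ := (((σ : ℤ) : ℝ) * y i) ^ (-(1 : ℝ) / (α i))
      if j = i then s else s ^ α j * y j
  | poincare β c => fun y j =>
      y j / ((1 + pnorm β c y ^ (2 * c)) ^ ((1 : ℝ) / (2 * c))) ^ α j
  | parabolic β c => fun y j => y j / (kappaRoot c (pnorm β c y)) ^ α j

/-- The image `𝓓` of `T`. -/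
def domain {n : ℕ} : Compactification n → Set (Fin n → ℝ)
  | directional i _ => {z | 0 < z i}
  | poincare β c => {x | pnorm β c x < 1}
  | parabolic β c => {x | pnorm β c x < 1}

/-- The horizon `𝓔`. -/
def horizon {n : ℕ} : Compactification n → Set (Fin n → ℝ)
  | directional i _ => {z | z i = 0}
  | poincare β c => {x | pnorm β c x = 1}
  | parabolic β c => {x | pnorm β c x = 1}

/-- The scaling factor in the coordinates of the compactified space: `s⁻¹` for a directional
compactification, and `κ` as a function of `x = T(y)` for the global ones. -/
def kappa {n : ℕ} : Compactification n → (Fin n → ℝ) → ℝ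
  | directional i _ => fun z => (z i)⁻¹
  | poincare β c => fun x => (1 - pnorm β c x ^ (2 * c)) ^ (-(1 : ℝ) / (2 * c))
  | parabolic β c => fun x => (1 - pnorm β c x ^ (2 * c))⁻¹

/-- The inverse of `T`, from `𝓓` to the original phase space. -/
def Tinv {n : ℕ} (α : Fin n → ℕ) : Compactification n → (Fin n → ℝ) → (Fin n → ℝ)
  | directional i σ => fun z =>
      dil α ((directional i σ).kappa z) (Function.update z i ((σ : ℤ) : ℝ))
  | poincare β c => fun x => dil α ((poincare β c).kappa x) x
  | parabolic β c => fun x => dil α ((parabolic β c).kappa x) x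

/-- The rescaled vector field: `f̂_j = s^{k+α_j} f_j(T⁻¹(s, x̂))` in the directional case, and
`f̃_j = κ^{-(k+α_j)} f_j(κ^{α₁} x₁, …, κ^{αₙ} xₙ)` in the global cases. -/
def ftilde {n : ℕ} (α : Fin n → ℕ) (k : ℕ) (f : (Fin n → ℝ) → (Fin n → ℝ))
    (C : Compactification n) (x : Fin n → ℝ) : Fin n → ℝ :=
  fun j => f (C.Tinv α x) j / C.kappa x ^ (k + α j)

/-- The desingularized vector field `g` on `𝓓`, in the time variable `τ` given by
`dt = S(x) dτ` with `S = timeFactor`.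

Directional: `ds/dτ = -σ s f̂_i / α_i` and `dx̂_j/dτ = f̂_j - σ (α_j / α_i) x̂_j f̂_i`.
Poincaré: `f̃_i - α_i x_i ∑_j (∇κ)_j κ^{α_j - 1} f̃_j`, where
`(∇κ)_j κ^{α_j - 1} = x_j^{2β_j-1} / α_j`.
Parabolic: the same expression multiplied by `w = 1 - (2c-1)/(2c) (1 - p(x)^{2c})`, where now
`(∇κ)_j κ^{α_j - 1} = x_j^{2β_j-1} / (α_j w)`. -/
def desing {n : ℕ} (α : Fin n → ℕ) (k : ℕ) (f : (Fin n → ℝ) → (Fin n → ℝ)) :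
    Compactification n → (Fin n → ℝ) → (Fin n → ℝ)
  | directional i σ => fun z j =>
      let fh := (directional i σ).ftilde α k f z
      if j = i then -((σ : ℤ) : ℝ) * z i * (fh i / α i)
      else fh j - ((σ : ℤ) : ℝ) * (α j * z j * (fh i / α i))
  | poincare β c => fun x i =>
      let ft := (poincare β c).ftilde α k f x
      ft i - α i * x i * ∑ j, x j ^ (2 * β j - 1) / α j * ft j
  | parabolic β c => fun x i =>
      let ft := (parabolic β c).ftilde α k f x
      let w : ℝ := 1 - (2 * c - 1) / (2 * c) * (1 - pnorm β c x ^ (2 * c))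
      w * (ft i - α i * x i * ∑ j, x j ^ (2 * β j - 1) / (α j * w) * ft j)

/-- The factor `S` of the time-scale desingularization, `dt = S(x) dτ`; the exponent `k / (2c)`
of the Poincaré type is an exact quotient of natural numbers by `Admissible`. -/
def timeFactor {n : ℕ} (k : ℕ) : Compactification n → (Fin n → ℝ) → ℝ
  | directional i _ => fun z => z i ^ k
  | poincare β c => fun x => (1 - pnorm β c x ^ (2 * c)) ^ (k / (2 * c))
  | parabolic β c => fun x =>
      (1 - (2 * c - 1) / (2 * c) * (1 - pnorm β c x ^ (2 * c))) *
        (1 - pnorm β c x ^ (2 * c)) ^ k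

/-- The preimage `T⁻¹(W)` in the original phase space. -/
def preimage {n : ℕ} (α : Fin n → ℕ) (C : Compactification n) (W : Set (Fin n → ℝ)) :
    Set (Fin n → ℝ) :=
  {y | y ∈ C.source ∧ C.T α y ∈ W}

end Compactification

/-! ### Parameterization of a local stable manifold -/

/-- The real points of the closed unit polydisc `B_1^m`. -/
def polydisc (m : ℕ) : Set (Fin m → ℝ) := {θ | ∀ i, |θ i| ≤ 1}

/-- The real points of the open unit polydisc. -/
def openPolydisc (m : ℕ) : Set (Fin m → ℝ) := {θ | ∀ i, |θ i| < 1}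

/-- The power series `P(θ) = ∑ a_γ θ^γ` with vector coefficients. -/
def powerSeries {n m : ℕ} (a : (Fin m → ℕ) → (Fin n → ℝ)) (θ : Fin m → ℝ) : Fin n → ℝ :=
  ∑' γ : Fin m → ℕ, (∏ i, θ i ^ γ i) • a γ

/-- The linear flow `e^{Λτ} θ` with `Λ = diag(lam)`. -/
def linFlow {m : ℕ} (lam : Fin m → ℝ) (τ : ℝ) (θ : Fin m → ℝ) : Fin m → ℝ :=
  fun i => Real.exp (lam i * τ) * θ i

/-- The polynomial vector field with components `g`. -/
def polyField {n : ℕ} (g : Fin n → MvPolynomial (Fin n) ℝ) (x : Fin n → ℝ) : Fin n → ℝ :=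
  fun i => MvPolynomial.eval x (g i)

/-- The Jacobian matrix of a polynomial vector field at `p`, as a linear map. -/
def jacobian {n : ℕ} (g : Fin n → MvPolynomial (Fin n) ℝ) (p : Fin n → ℝ) :
    Module.End ℝ (Fin n → ℝ) :=
  Matrix.toLin' (Matrix.of fun i j => MvPolynomial.eval p (MvPolynomial.pderiv j (g i)))

/-- The requirements on an analytic parameterization `P = powerSeries a` of a local stable
manifold `P(B_1^m)` of the equilibrium `p` of the polynomial vector field `g`. -/
structure IsStableParameterization {n m : ℕ} (g : Fin n → MvPolynomial (Fin n) ℝ)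
    (p : Fin n → ℝ) (lam : Fin m → ℝ) (ξ : Fin m → Fin n → ℝ)
    (a : (Fin m → ℕ) → (Fin n → ℝ)) : Prop where
  /-- `p` is an equilibrium. -/
  equilibrium : polyField g p = 0
  /-- The eigenvalues of `Dg(p)` are real, nonzero and distinct. -/
  hyperbolic : ∃ μ : Fin n → ℝ, Function.Injective μ ∧
    ∀ i, μ i ≠ 0 ∧ (jacobian g p).HasEigenvalue (μ i)
  /-- `lam` lists the stable (negative) eigenvalues, without repetition. -/
  lam_injective : Function.Injective lam
  lam_stable : ∀ r : ℝ, (r < 0 ∧ (jacobian g p).HasEigenvalue r) ↔ ∃ j, lam j = r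
  /-- `ξ j` is an eigenvector for `lam j`. -/
  eigenvector : ∀ j, (jacobian g p).HasEigenvector (lam j) (ξ j)
  /-- The stable eigenvalues are non-resonant. -/
  nonresonant : ∀ γ : Fin m → ℕ, 2 ≤ ∑ i, γ i → ∀ j, ∑ i, (γ i : ℝ) * lam i ≠ lam j
  /-- The power series converges absolutely on the closed unit polydisc. -/
  summable : Summable fun γ => ‖a γ‖
  /-- `P(0) = p`. -/
  coeff_zero : a 0 = p
  /-- `DP(0)` has the columns `ξ j`. -/
  coeff_single : ∀ j, a (Pi.single j 1) = ξ j
  /-- `P` conjugates the linear flow with the flow of `g`: for `θ` in the polydisc,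
  `τ ↦ P(e^{Λτ} θ)` is the solution of `x' = g(x)` on `[0, ∞)` that starts at `P(θ)`. -/
  conjugacy : ∀ θ ∈ polydisc m, ∀ τ ∈ Ici (0 : ℝ),
    HasDerivWithinAt (fun r => powerSeries a (linFlow lam r θ))
      (polyField g (powerSeries a (linFlow lam τ θ))) (Ici 0) τ

end BlowUp

end

namespace BlowUp

/-! ### Absolutely convergent power series on the unit polydisc -/

/-! Blow-up is convergence to an equilibrium at infinity seen through a time change. For `θ` in the
polydisc with `P(θ)` in the domain, the curve `P(e^{Λτ}θ)` converges to `p` on the horizon as `τ →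
∞`. The inverse compactification carries it to a solution of `y' = f(y)` in the time `t = ∫ S dτ`
(`hasDerivWithinAt_Tinv`, `exists_isSolutionOn_of_timeChange`), and this solution leaves every
bounded set, so the maximal existence time is the full integral of `S` (`IsSolutionOn.tmax_eq`). The
curve never reaches the horizon at finite `τ`: the defining function of the horizon has a bounded
logarithmic derivative along the flow, by asymptotic quasi-homogeneity
(`mem_domain_of_hasDerivWithinAt`).

The integral is analytic in `θ` for an algebraic reason. `S` is a polynomial vanishing at `p`, so `S
∘ P` is an absolutely convergent power series `∑ b_γ θ^γ` with `b_0 = 0`. Along the linear flow the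
monomial `θ^γ` is multiplied by `e^{(γ·λ)τ}`, and termwise integration gives `∑ b_γ/(-γ·λ) θ^γ`. The
divisors are bounded away from zero because all `λ_i` are negative
(`HasExpansion.integral_linFlow`).

It remains to express `θ` analytically through `y`. `P` is injective with injective derivative: this
holds near `0` because the eigenvectors are independent, and the contracting linear flow together
with Gronwall's inequality spreads it over the polydisc (`injOn`, `fderiv_injective`). Hence `P` has
local analytic left inverses `R`, and near a point of `V` the blow-up time is the series evaluated
at `R(T(y))`. Finally, a topological interior point of `V` has a parameter in the open polydisc:
flow backwards a little inside `W`, then forwards again (`mem_openPolydisc_of_image_mem_nhds`). -/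

theorem norm_monomial_le_one {m : ℕ} {θ : Fin m → ℝ} (hθ : θ ∈ polydisc m) (γ : Fin m → ℕ) :
    ‖∏ i, θ i ^ γ i‖ ≤ 1 := by
  rw [Real.norm_eq_abs, Finset.abs_prod]
  refine Finset.prod_le_one (fun i _ => abs_nonneg _) fun i _ => ?_
  rw [abs_pow]
  exact pow_le_one₀ (abs_nonneg _) (hθ i)

theorem openPolydisc_subset (m : ℕ) : openPolydisc m ⊆ polydisc m := fun _ h i => (h i).le

theorem isOpen_openPolydisc (m : ℕ) : IsOpen (openPolydisc m) := by
  have : openPolydisc m = ⋂ i, {θ : Fin m → ℝ | |θ i| < 1} := by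
    ext; simp [openPolydisc]
  rw [this]
  exact isOpen_iInter_of_finite fun i => isOpen_lt (by fun_prop) continuous_const

theorem zero_mem_openPolydisc (m : ℕ) : (0 : Fin m → ℝ) ∈ openPolydisc m := by
  intro i; simp

theorem isCompact_polydisc (m : ℕ) : IsCompact (polydisc m) := by
  have : polydisc m = Set.pi univ fun _ => Icc (-1 : ℝ) 1 := by
    ext; simp [polydisc, abs_le, -pi_univ_Icc]
  rw [this]
  exact isCompact_univ_pi fun _ => isCompact_Icc

theorem ball_subset_openPolydisc (m : ℕ) : Metric.ball (0 : Fin m → ℝ) 1 ⊆ openPolydisc m := by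
  intro θ hθ i
  rw [mem_ball_zero_iff] at hθ
  exact (norm_le_pi_norm θ i).trans_lt hθ

theorem openPolydisc_subset_ball {m : ℕ} : openPolydisc m ⊆ Metric.ball (0 : Fin m → ℝ) 1 := by
  intro θ hθ
  rw [mem_ball_zero_iff, pi_norm_lt_iff one_pos]
  exact hθ

/-- Regrouping by total degree turns a multi-index series into a series of homogeneous parts, the
shape of a `FormalMultilinearSeries`. -/
theorem hasSum_sum_piAntidiag {E : Type*} [NormedAddCommGroup E] [CompleteSpace E] {m : ℕ}
    {b : (Fin m → ℕ) → E} {s : E} (hb : HasSum b s) :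
    HasSum (fun d => ∑ γ ∈ Finset.piAntidiag Finset.univ d, b γ) s := by
  have h := hb.tsum_fiberwise (fun γ : Fin m → ℕ => ∑ i, γ i)
  refine h.congr_fun fun d => ?_
  rw [← Finset.tsum_subtype]
  have : ((Finset.piAntidiag Finset.univ d : Finset (Fin m → ℕ)) : Set (Fin m → ℕ)) =
      (fun γ : Fin m → ℕ => ∑ i, γ i) ⁻¹' {d} := by
    ext γ; simp
  exact congrArg (fun s : Set (Fin m → ℕ) => ∑' γ : s, b γ) this

section

variable {E : Type*} [NormedAddCommGroup E] [NormedSpace ℝ E]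

theorem norm_monomial_smul_le {m : ℕ} {θ : Fin m → ℝ} (hθ : θ ∈ polydisc m) (γ : Fin m → ℕ)
    (v : E) : ‖(∏ i, θ i ^ γ i) • v‖ ≤ ‖v‖ := by
  rw [norm_smul]
  exact mul_le_of_le_one_left (norm_nonneg _) (norm_monomial_le_one hθ γ)

variable [CompleteSpace E]

theorem summable_monomial_smul {m : ℕ} {a : (Fin m → ℕ) → E} (ha : Summable fun γ => ‖a γ‖)
    {θ : Fin m → ℝ} (hθ : θ ∈ polydisc m) : Summable fun γ => (∏ i, θ i ^ γ i) • a γ :=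
  ha.of_norm_bounded (norm_monomial_smul_le hθ · _)

theorem continuousOn_tsum_monomial {m : ℕ} {a : (Fin m → ℕ) → E}
    (ha : Summable fun γ => ‖a γ‖) :
    ContinuousOn (fun θ : Fin m → ℝ => ∑' γ, (∏ i, θ i ^ γ i) • a γ) (polydisc m) :=
  continuousOn_tsum (fun γ => by fun_prop) ha fun γ _ hθ => norm_monomial_smul_le hθ γ _

/-- The monomial `θ^γ`, polarized. -/
theorem exists_multilinear_monomial {m d : ℕ} (γ : Fin m → ℕ) (hd : ∑ i, γ i = d) :
    ∃ M : ContinuousMultilinearMap ℝ (fun _ : Fin d => (Fin m → ℝ)) ℝ,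
      ‖M‖ ≤ 1 ∧ ∀ θ : Fin m → ℝ, M (fun _ => θ) = ∏ i, θ i ^ γ i := by
  subst hd
  -- `w` is a word in which each index `i` occurs `γ i` times; the product of coordinates along it
  -- is multilinear and restricts to the monomial on the diagonal.
  let w : Fin (∑ i, γ i) → Fin m := fun j => (finSigmaFinEquiv.symm j).1
  refine ⟨(ContinuousMultilinearMap.mkPiAlgebra ℝ (Fin (∑ i, γ i)) ℝ).compContinuousLinearMap
    fun j => ContinuousLinearMap.proj (w j), ?_, fun θ => ?_⟩
  · refine ContinuousMultilinearMap.opNorm_le_bound zero_le_one fun v => ?_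
    simp only [ContinuousMultilinearMap.compContinuousLinearMap_apply,
      ContinuousLinearMap.proj_apply, ContinuousMultilinearMap.mkPiAlgebra_apply, one_mul]
    rw [norm_prod]
    exact Finset.prod_le_prod (fun _ _ => norm_nonneg _) fun j _ => norm_le_pi_norm (v j) (w j)
  · simp only [ContinuousMultilinearMap.compContinuousLinearMap_apply,
      ContinuousLinearMap.proj_apply, ContinuousMultilinearMap.mkPiAlgebra_apply, w]
    rw [Equiv.prod_comp finSigmaFinEquiv.symm (fun s => θ s.1), Fintype.prod_sigma]
    simp

/-- Polarized monomials have norm at most one, so the degree `d` term is bounded by the sum of `‖a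
γ‖` over `|γ| = d`, and the radius is at least one. For the sup norm the unit ball is the open
polydisc. -/
theorem exists_hasFPowerSeriesOnBall {m : ℕ} {a : (Fin m → ℕ) → E}
    (ha : Summable fun γ => ‖a γ‖) :
    ∃ p : FormalMultilinearSeries ℝ (Fin m → ℝ) E,
      (∀ d θ, p d (fun _ => θ) =
        ∑ γ ∈ Finset.piAntidiag Finset.univ d, (∏ i, θ i ^ γ i) • a γ) ∧
      HasFPowerSeriesOnBall (fun θ : Fin m → ℝ => ∑' γ, (∏ i, θ i ^ γ i) • a γ) p 0 1 := by
  have hM : ∀ γ : Fin m → ℕ, ∀ d, ∃ M : ContinuousMultilinearMap ℝ (fun _ : Fin d => (Fin m → ℝ)) ℝ,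
      ‖M‖ ≤ 1 ∧ (∑ i, γ i = d → ∀ θ : Fin m → ℝ, M (fun _ => θ) = ∏ i, θ i ^ γ i) := by
    intro γ d
    by_cases h : ∑ i, γ i = d
    · obtain ⟨M, h1, h2⟩ := exists_multilinear_monomial γ h
      exact ⟨M, h1, fun _ => h2⟩
    · exact ⟨0, by simp, fun h' => absurd h' h⟩
  choose M hM1 hM2 using hM
  let p : FormalMultilinearSeries ℝ (Fin m → ℝ) E := fun d =>
    ∑ γ ∈ Finset.piAntidiag Finset.univ d, (M γ d).smulRight (a γ)
  have hp : ∀ d θ, p d (fun _ => θ) =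
      ∑ γ ∈ Finset.piAntidiag Finset.univ d, (∏ i, θ i ^ γ i) • a γ := by
    intro d θ
    simp only [p, _root_.sum_apply]
    refine Finset.sum_congr rfl fun γ hγ => ?_
    rw [Finset.mem_piAntidiag] at hγ
    rw [ContinuousMultilinearMap.smulRight_apply, hM2 γ d hγ.1]
  refine ⟨p, hp, ?_, one_pos, ?_⟩
  · have : ((1 : NNReal) : ℝ≥0∞) ≤ p.radius := by
      refine p.le_radius_of_summable_norm ?_
      simp only [NNReal.coe_one, one_pow, mul_one]
      refine (hasSum_sum_piAntidiag ha.hasSum).summable.of_nonneg_of_le (fun _ => norm_nonneg _)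
        fun d => (norm_sum_le _ _).trans (Finset.sum_le_sum fun γ _ => ?_)
      rw [ContinuousMultilinearMap.norm_smulRight]
      exact mul_le_of_le_one_left (norm_nonneg _) (hM1 γ d)
    simpa using this
  · intro θ hθ
    have hθ' : θ ∈ polydisc m := by
      apply openPolydisc_subset
      apply ball_subset_openPolydisc
      simpa [← ENNReal.ofReal_one, Metric.eball_ofReal] using hθ
    simp only [hp, zero_add]
    exact hasSum_sum_piAntidiag (summable_monomial_smul ha hθ').hasSum

theorem analyticAt_tsum_monomial {m : ℕ} {a : (Fin m → ℕ) → E}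
    (ha : Summable fun γ => ‖a γ‖) {θ : Fin m → ℝ} (hθ : θ ∈ openPolydisc m) :
    AnalyticAt ℝ (fun θ : Fin m → ℝ => ∑' γ, (∏ i, θ i ^ γ i) • a γ) θ := by
  obtain ⟨p, -, hp⟩ := exists_hasFPowerSeriesOnBall ha
  refine hp.analyticAt_of_mem ?_
  have := openPolydisc_subset_ball hθ
  rwa [← Metric.eball_ofReal, ENNReal.ofReal_one] at this

/-- The derivative at the origin is read off the linear coefficients. -/
theorem hasStrictFDerivAt_tsum_monomial_zero {m : ℕ} {a : (Fin m → ℕ) → E}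
    (ha : Summable fun γ => ‖a γ‖) :
    ∃ L : (Fin m → ℝ) →L[ℝ] E, (∀ v, L v = ∑ j, v j • a (Pi.single j 1)) ∧
      HasStrictFDerivAt (fun θ : Fin m → ℝ => ∑' γ, (∏ i, θ i ^ γ i) • a γ) L 0 := by
  obtain ⟨p, hp1, hp⟩ := exists_hasFPowerSeriesOnBall ha
  refine ⟨_, fun v => ?_, hp.hasFPowerSeriesAt.hasStrictFDerivAt⟩
  rw [continuousMultilinearCurryFin1_apply]
  have : (Fin.snoc 0 v : Fin 1 → (Fin m → ℝ)) = fun _ => v := by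
    ext i; fin_cases i; rfl
  rw [this, hp1]
  have hset : (Finset.piAntidiag Finset.univ 1 : Finset (Fin m → ℕ)) =
      Finset.univ.image fun j => Pi.single j 1 := by
    ext γ
    simp only [Finset.mem_piAntidiag, Finset.mem_image, Finset.mem_univ, true_and, implies_true,
      and_true]
    constructor
    · intro h
      obtain ⟨j, -, hj⟩ := Finset.exists_ne_zero_of_sum_ne_zero (h ▸ one_ne_zero : ∑ i, γ i ≠ 0)
      refine ⟨j, ?_⟩
      rw [← Finset.add_sum_erase _ _ (Finset.mem_univ j)] at h
      have h0 : ∑ i ∈ Finset.univ.erase j, γ i = 0 := by omega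
      rw [Finset.sum_eq_zero_iff] at h0
      ext i
      by_cases hi : i = j
      · subst hi; simp; omega
      · rw [Pi.single_eq_of_ne hi, h0 i (by simp [hi])]
    · rintro ⟨j, rfl⟩
      simp
  rw [hset, Finset.sum_image]
  · refine Finset.sum_congr rfl fun j _ => ?_
    congr 1
    rw [Finset.prod_eq_single j]
    · simp
    · intro i _ hi; simp [Pi.single_eq_of_ne hi]
    · simp
  · intro i _ j _ h
    by_contra hij
    have := congrFun h i
    simp [Pi.single_eq_of_ne hij] at this

end

/-! ### The algebra of functions with an absolutely convergent expansion -/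

/-- `h` is the sum of an absolutely convergent power series on the closed polydisc. -/
def HasExpansion {m : ℕ} (h : (Fin m → ℝ) → ℝ) : Prop :=
  ∃ b : (Fin m → ℕ) → ℝ, (Summable fun γ => ‖b γ‖) ∧
    ∀ θ ∈ polydisc m, h θ = ∑' γ, (∏ i, θ i ^ γ i) • b γ

/-- Coefficients sharing an exponent are summed over the fibres of `e`. This serves products, where
the pair `(γ, γ')` carries the exponent `γ + γ'`. -/
theorem HasExpansion.of_index {m : ℕ} {h : (Fin m → ℝ) → ℝ} {ι : Type*} (e : ι → Fin m → ℕ)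
    (c : ι → ℝ) (hc : Summable fun i => ‖c i‖)
    (hh : ∀ θ ∈ polydisc m, h θ = ∑' x, (∏ i, θ i ^ e x i) • c x) : HasExpansion h := by
  refine ⟨fun γ => ∑' x : e ⁻¹' {γ}, c x, ?_, fun θ hθ => ?_⟩
  · refine (hc.hasSum.tsum_fiberwise e).summable.of_nonneg_of_le (fun _ => norm_nonneg _)
      fun γ => norm_tsum_le_tsum_norm (hc.subtype _)
  · have hs : Summable fun x => (∏ i, θ i ^ e x i) • c x :=
      hc.of_norm_bounded fun x => norm_monomial_smul_le hθ (e x) (c x)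
    rw [hh θ hθ, ← (hs.hasSum.tsum_fiberwise e).tsum_eq]
    refine tsum_congr fun γ => ?_
    rw [smul_eq_mul, ← tsum_mul_left]
    refine tsum_congr fun x => ?_
    rw [show e x = γ from x.2, smul_eq_mul]

theorem HasExpansion.const {m : ℕ} (r : ℝ) : HasExpansion fun _ : Fin m → ℝ => r :=
  .of_index (ι := Unit) (fun _ => 0) (fun _ => r) (Summable.of_finite) (by simp)

theorem HasExpansion.add {m : ℕ} {h₁ h₂ : (Fin m → ℝ) → ℝ} (H₁ : HasExpansion h₁)
    (H₂ : HasExpansion h₂) : HasExpansion fun θ => h₁ θ + h₂ θ := by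
  obtain ⟨b₁, s₁, e₁⟩ := H₁
  obtain ⟨b₂, s₂, e₂⟩ := H₂
  refine ⟨fun γ => b₁ γ + b₂ γ, (s₁.add s₂).of_nonneg_of_le (fun _ => norm_nonneg _)
    (fun γ => norm_add_le _ _), fun θ hθ => ?_⟩
  simp only [e₁ θ hθ, e₂ θ hθ, smul_add]
  exact ((summable_monomial_smul s₁ hθ).tsum_add (summable_monomial_smul s₂ hθ)).symm

theorem HasExpansion.mul {m : ℕ} {h₁ h₂ : (Fin m → ℝ) → ℝ} (H₁ : HasExpansion h₁)
    (H₂ : HasExpansion h₂) : HasExpansion fun θ => h₁ θ * h₂ θ := by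
  obtain ⟨b₁, s₁, e₁⟩ := H₁
  obtain ⟨b₂, s₂, e₂⟩ := H₂
  refine .of_index (ι := (Fin m → ℕ) × (Fin m → ℕ)) (fun x => x.1 + x.2) (fun x => b₁ x.1 * b₂ x.2)
    (s₁.mul_norm s₂) fun θ hθ => ?_
  rw [e₁ θ hθ, e₂ θ hθ, tsum_mul_tsum_of_summable_norm
    (s₁.of_nonneg_of_le (fun _ => norm_nonneg _) fun γ => norm_monomial_smul_le hθ γ _)
    (s₂.of_nonneg_of_le (fun _ => norm_nonneg _) fun γ => norm_monomial_smul_le hθ γ _)]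
  refine tsum_congr fun x => ?_
  simp only [smul_eq_mul, Pi.add_apply, pow_add, Finset.prod_mul_distrib]
  ring

theorem hasExpansion_powerSeries_apply {n m : ℕ} {a : (Fin m → ℕ) → (Fin n → ℝ)}
    (ha : Summable fun γ => ‖a γ‖) (j : Fin n) : HasExpansion fun θ => powerSeries a θ j := by
  refine ⟨fun γ => a γ j, ha.of_nonneg_of_le (fun _ => norm_nonneg _)
    (fun γ => norm_le_pi_norm (a γ) j), fun θ hθ => ?_⟩
  exact tsum_apply (summable_monomial_smul ha hθ)

theorem hasExpansion_eval_powerSeries {n m : ℕ} {a : (Fin m → ℕ) → (Fin n → ℝ)}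
    (ha : Summable fun γ => ‖a γ‖) (s : MvPolynomial (Fin n) ℝ) :
    HasExpansion fun θ => MvPolynomial.eval (powerSeries a θ) s := by
  induction s using MvPolynomial.induction_on with
  | C r => simpa using HasExpansion.const r
  | add p q hp hq => simpa using hp.add hq
  | mul_X p j hp => simpa using hp.mul (hasExpansion_powerSeries_apply ha j)

/-! ### Integration along the linear flow -/

theorem linFlow_zero {m : ℕ} (lam : Fin m → ℝ) (θ : Fin m → ℝ) : linFlow lam 0 θ = θ := by
  ext i; simp [linFlow]

theorem linFlow_mem_polydisc {m : ℕ} {lam : Fin m → ℝ} (hlam : ∀ i, lam i < 0) {θ : Fin m → ℝ}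
    (hθ : θ ∈ polydisc m) {τ : ℝ} (hτ : 0 ≤ τ) : linFlow lam τ θ ∈ polydisc m := by
  intro i
  rw [linFlow, abs_mul, Real.abs_exp]
  exact mul_le_one₀ (Real.exp_le_one_iff.2 (mul_nonpos_of_nonpos_of_nonneg (hlam i).le hτ))
    (abs_nonneg _) (hθ i)

theorem linFlow_mem_openPolydisc {m : ℕ} {lam : Fin m → ℝ} (hlam : ∀ i, lam i < 0)
    {θ : Fin m → ℝ} (hθ : θ ∈ polydisc m) {τ : ℝ} (hτ : 0 < τ) :
    linFlow lam τ θ ∈ openPolydisc m := by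
  intro i
  rw [linFlow, abs_mul, Real.abs_exp]
  have h1 : Real.exp (lam i * τ) < 1 := Real.exp_lt_one_iff.2 (mul_neg_of_neg_of_pos (hlam i) hτ)
  exact (mul_le_of_le_one_right (Real.exp_pos _).le (hθ i)).trans_lt h1

theorem tendsto_linFlow {m : ℕ} {lam : Fin m → ℝ} (hlam : ∀ i, lam i < 0) (θ : Fin m → ℝ) :
    Tendsto (fun τ => linFlow lam τ θ) atTop (𝓝 0) := by
  rw [tendsto_pi_nhds]
  intro i
  have : Tendsto (fun τ => Real.exp (lam i * τ)) atTop (𝓝 0) :=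
    Real.tendsto_exp_atBot.comp (tendsto_id.const_mul_atTop_of_neg (hlam i))
  simpa [linFlow] using this.mul_const (θ i)

theorem continuous_linFlow {m : ℕ} (lam : Fin m → ℝ) (θ : Fin m → ℝ) :
    Continuous fun τ => linFlow lam τ θ := by
  unfold linFlow; fun_prop

/-- Monomials are eigenfunctions of the diagonal flow, so their time integrals are explicit. -/
theorem monomial_linFlow {m : ℕ} (lam θ : Fin m → ℝ) (τ : ℝ) (γ : Fin m → ℕ) :
    ∏ i, linFlow lam τ θ i ^ γ i = Real.exp ((∑ i, γ i * lam i) * τ) * ∏ i, θ i ^ γ i := by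
  simp only [linFlow, mul_pow, Finset.prod_mul_distrib, Finset.sum_mul, Real.exp_sum]
  congr 1
  refine Finset.prod_congr rfl fun i _ => ?_
  rw [← Real.exp_nat_mul, mul_assoc]

/-- A spectral gap for the linear flow. -/
theorem exists_gap {m : ℕ} {lam : Fin m → ℝ} (hlam : ∀ i, lam i < 0) :
    ∃ δ : ℝ, 0 < δ ∧ ∀ γ : Fin m → ℕ, γ ≠ 0 → ∑ i, γ i * lam i ≤ -δ := by
  obtain ⟨δ, hδ, h⟩ : ∃ δ : ℝ, 0 < δ ∧ ∀ i, lam i ≤ -δ := by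
    rcases isEmpty_or_nonempty (Fin m) with hm | hm
    · exact ⟨1, one_pos, fun i => hm.elim i⟩
    · obtain ⟨j, hj⟩ := Finite.exists_max lam
      exact ⟨-lam j, neg_pos.2 (hlam j), fun i => by simpa using hj i⟩
  refine ⟨δ, hδ, fun γ hγ => ?_⟩
  obtain ⟨j, hj⟩ := Function.ne_iff.1 hγ
  have hj' : (1 : ℝ) ≤ γ j := by exact_mod_cast Nat.one_le_iff_ne_zero.2 hj
  -- All terms are nonpositive, so a single nonzero exponent `γ j` already yields the gap.
  calc ∑ i, γ i * lam i ≤ ∑ i, if i = j then γ i * lam i else 0 := by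
        refine Finset.sum_le_sum fun i _ => ?_
        split_ifs
        · rfl
        · exact mul_nonpos_of_nonneg_of_nonpos (Nat.cast_nonneg _) (hlam i).le
    _ = γ j * lam j := by simp
    _ ≤ -δ := by nlinarith [h j]

/-- Integrals of functions with an expansion along the linear flow. -/
theorem HasExpansion.integral_linFlow {m : ℕ} {lam : Fin m → ℝ} (hlam : ∀ i, lam i < 0)
    {h : (Fin m → ℝ) → ℝ} (H : HasExpansion h) (h0 : h 0 = 0) :
    ∃ c : (Fin m → ℕ) → ℝ, (Summable fun γ => ‖c γ‖) ∧ ∀ θ ∈ polydisc m,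
      IntegrableOn (fun τ => h (linFlow lam τ θ)) (Ioi 0) ∧
      ∫ τ in Ioi (0 : ℝ), h (linFlow lam τ θ) = ∑' γ, (∏ i, θ i ^ γ i) • c γ := by
  obtain ⟨b, hb, he⟩ := H
  obtain ⟨δ, hδ, hgap⟩ := exists_gap hlam
  -- The constant term is the only one that does not decay along the flow.
  have hb0 : b 0 = 0 := by
    rw [he 0 (openPolydisc_subset m (zero_mem_openPolydisc m)), tsum_eq_single 0] at h0
    · simpa using h0
    · intro γ hγ
      obtain ⟨j, hj⟩ := Function.ne_iff.1 hγ
      rw [Finset.prod_eq_zero (Finset.mem_univ j) (by simpa using hj), zero_smul]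
  set μ : (Fin m → ℕ) → ℝ := fun γ => ∑ i, γ i * lam i with hμ
  have hμneg : ∀ γ, γ ≠ 0 → μ γ < 0 := fun γ hγ => (hgap γ hγ).trans_lt (neg_lt_zero.2 hδ)
  have hcb : ∀ γ, ‖b γ / (-μ γ)‖ ≤ ‖b γ‖ / δ := by
    intro γ
    by_cases hγ : γ = 0
    · simp [hγ, hb0]
    · rw [norm_div, norm_neg]
      refine div_le_div_of_nonneg_left (norm_nonneg _) hδ ?_
      rw [Real.norm_eq_abs, abs_of_neg (hμneg γ hγ)]
      linarith [hgap γ hγ]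
  -- The factor `1/(-μ γ)` is the integral of `e^{μτ}` over the half-line; at `γ = 0` the quotient
  -- is `0/0 = 0`, which is the right value.
  refine ⟨fun γ => b γ / (-μ γ), (hb.div_const δ).of_nonneg_of_le (fun _ => norm_nonneg _) hcb,
    fun θ hθ => ?_⟩
  set F : (Fin m → ℕ) → ℝ → ℝ := fun γ τ => Real.exp (μ γ * τ) * ((∏ i, θ i ^ γ i) * b γ) with hF
  have hFint : ∀ γ, IntegrableOn (F γ) (Ioi 0) := by
    intro γ
    by_cases hγ : γ = 0
    · simp only [hF, hγ, hb0, mul_zero]; exact integrableOn_zero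
    · exact (integrableOn_exp_mul_Ioi (hμneg γ hγ) 0).mul_const _
  have hFval : ∀ γ, ∫ τ in Ioi (0 : ℝ), F γ τ = (∏ i, θ i ^ γ i) • (b γ / (-μ γ)) := by
    intro γ
    by_cases hγ : γ = 0
    · simp [hF, hγ, hb0]
    · simp only [hF]
      rw [integral_mul_const, integral_exp_mul_Ioi (hμneg γ hγ)]
      simp only [mul_zero, Real.exp_zero, smul_eq_mul]
      have := (hμneg γ hγ).ne
      field_simp
  have hFnorm : ∀ γ, ∫ τ in Ioi (0 : ℝ), ‖F γ τ‖ = ‖(∏ i, θ i ^ γ i) • (b γ / (-μ γ))‖ := by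
    intro γ
    by_cases hγ : γ = 0
    · simp [hF, hγ, hb0]
    · simp only [hF, norm_mul, Real.norm_eq_abs, Real.abs_exp]
      rw [integral_mul_const, integral_exp_mul_Ioi (hμneg γ hγ)]
      simp only [mul_zero, Real.exp_zero, smul_eq_mul, abs_mul, abs_div, abs_neg,
        abs_of_neg (hμneg γ hγ)]
      have := (hμneg γ hγ).ne
      field_simp
  have hsum : Summable fun γ => ∫ τ in Ioi (0 : ℝ), ‖F γ τ‖ := by
    simp only [hFnorm]
    exact (hb.div_const δ).of_nonneg_of_le (fun _ => norm_nonneg _)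
      fun γ => (norm_monomial_smul_le hθ γ _).trans (hcb γ)
  have heq : EqOn (fun τ => h (linFlow lam τ θ)) (fun τ => ∑' γ, F γ τ) (Ioi 0) := by
    intro τ hτ
    simp only
    rw [he _ (linFlow_mem_polydisc hlam hθ (le_of_lt hτ))]
    refine tsum_congr fun γ => ?_
    rw [monomial_linFlow, smul_eq_mul, mul_assoc]
  have h1 := hasSum_integral_of_summable_integral_norm hFint hsum
  constructor
  · have hcont : ContinuousOn (fun τ => h (linFlow lam τ θ)) (Ioi 0) := by
      refine ContinuousOn.congr (f := fun τ => ∑' γ, (∏ i, linFlow lam τ θ i ^ γ i) • b γ) ?_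
        fun τ hτ => he _ (linFlow_mem_polydisc hlam hθ (le_of_lt hτ))
      exact (continuousOn_tsum_monomial hb).comp (continuous_linFlow lam θ).continuousOn
        fun τ hτ => linFlow_mem_polydisc hlam hθ (le_of_lt hτ)
    refine ((integrableOn_exp_mul_Ioi (neg_lt_zero.2 hδ) 0).mul_const (∑' γ, ‖b γ‖)).mono'
      (hcont.aestronglyMeasurable measurableSet_Ioi) ?_
    refine (ae_restrict_iff' measurableSet_Ioi).2 (ae_of_all _ fun τ hτ => ?_)
    have hbound : ∀ γ, ‖F γ τ‖ ≤ Real.exp (-δ * τ) * ‖b γ‖ := by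
      intro γ
      by_cases hγ : γ = 0
      · simp [hF, hγ, hb0]
      · rw [hF, norm_mul, Real.norm_eq_abs, Real.abs_exp]
        refine mul_le_mul ?_ (norm_monomial_smul_le hθ γ _) (norm_nonneg _) (Real.exp_pos _).le
        exact Real.exp_le_exp.2 (mul_le_mul_of_nonneg_right (hgap γ hγ) (le_of_lt hτ))
    rw [show h (linFlow lam τ θ) = ∑' γ, F γ τ from heq hτ, ← tsum_mul_left]
    exact tsum_of_norm_bounded (hb.mul_left _).hasSum hbound
  · rw [setIntegral_congr_fun measurableSet_Ioi heq, ← h1.tsum_eq]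
    exact tsum_congr hFval

/-! ### Solutions that blow up -/

theorem IsSolutionOn.continuousOn {n : ℕ} {f : (Fin n → ℝ) → (Fin n → ℝ)} {y : ℝ → Fin n → ℝ}
    {T : ℝ} (hy : IsSolutionOn f y T) : ContinuousOn y (Ico 0 T) :=
  fun t ht => (hy t ht).continuousWithinAt

theorem IsSolutionOn.hasDerivWithinAt_Ici {n : ℕ} {f : (Fin n → ℝ) → (Fin n → ℝ)}
    {y : ℝ → Fin n → ℝ} {T : ℝ} (hy : IsSolutionOn f y T) {t : ℝ} (ht : t ∈ Ico 0 T) :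
    HasDerivWithinAt y (f (y t)) (Ici t) t :=
  (hy t ht).mono_of_mem_nhdsWithin <| mem_of_superset (Ico_mem_nhdsGE ht.2)
    (Ico_subset_Ico_left ht.1)

theorem exists_lipschitzOnWith_closedBall {n : ℕ} {f : (Fin n → ℝ) → (Fin n → ℝ)}
    (hf : ContDiff ℝ 1 f) (R : ℝ) : ∃ K, LipschitzOnWith K f (Metric.closedBall 0 R) :=
  hf.contDiffOn.exists_lipschitzOnWith one_ne_zero (convex_closedBall 0 R)
    (isCompact_closedBall 0 R)

/-- On the compact interval `[0, t]` both curves lie in one ball, where `f` is Lipschitz. -/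
theorem IsSolutionOn.eqOn {n : ℕ} {f : (Fin n → ℝ) → (Fin n → ℝ)} (hf : ContDiff ℝ 1 f)
    {y z : ℝ → Fin n → ℝ} {T T' : ℝ} (hy : IsSolutionOn f y T) (hz : IsSolutionOn f z T')
    (h0 : y 0 = z 0) {t : ℝ} (ht : 0 ≤ t) (htT : t < T) (htT' : t < T') : y t = z t := by
  have sub : Icc 0 t ⊆ Ico 0 T := Icc_subset_Ico_right htT
  have sub' : Icc 0 t ⊆ Ico 0 T' := Icc_subset_Ico_right htT'
  obtain ⟨R, hR⟩ := ((isCompact_Icc.image_of_continuousOn (hy.continuousOn.mono sub)).union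
    (isCompact_Icc.image_of_continuousOn (hz.continuousOn.mono sub'))).isBounded.subset_closedBall 0
  obtain ⟨K, hK⟩ := exists_lipschitzOnWith_closedBall hf R
  exact ODE_solution_unique_of_mem_Icc_right (v := fun _ => f) (fun _ _ => hK)
    (hy.continuousOn.mono sub)
    (fun s hs => hy.hasDerivWithinAt_Ici (sub (Ico_subset_Icc_self hs)))
    (fun s hs => hR (Or.inl (mem_image_of_mem _ (Ico_subset_Icc_self hs))))
    (hz.continuousOn.mono sub')
    (fun s hs => hz.hasDerivWithinAt_Ici (sub' (Ico_subset_Icc_self hs)))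
    (fun s hs => hR (Or.inr (mem_image_of_mem _ (Ico_subset_Icc_self hs)))) h0 ⟨ht, le_rfl⟩

/-- A solution that leaves every bounded set realizes the maximal existence time. -/
theorem IsSolutionOn.tmax_eq {n : ℕ} {f : (Fin n → ℝ) → (Fin n → ℝ)} (hf : ContDiff ℝ 1 f)
    {y : ℝ → Fin n → ℝ} {T : ℝ} (hT : 0 < T) (hy : IsSolutionOn f y T)
    (hlim : Tendsto y (𝓝[<] T) (Bornology.cobounded (Fin n → ℝ))) :
    tmax f (y 0) = ENNReal.ofReal T := by
  refine le_antisymm (sSup_le ?_) (le_sSup ⟨T, rfl, y, rfl, hy⟩)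
  rintro _ ⟨T', rfl, z, hz0, hz⟩
  refine ENNReal.ofReal_le_ofReal (not_lt.1 fun hlt => ?_)
  -- A competitor living beyond `T` would have a finite limit at `T`, although it agrees with the
  -- divergent `y` before `T`.
  have hzc : Tendsto z (𝓝[<] T) (𝓝 (z T)) :=
    ((hz T ⟨hT.le, hlt⟩).continuousWithinAt.continuousAt (Ico_mem_nhds hT hlt)).mono_left
      nhdsWithin_le_nhds
  have heq : z =ᶠ[𝓝[<] T] y := by
    filter_upwards [Ioo_mem_nhdsLT hT] with t ht
    exact hz.eqOn hf hy hz0 ht.1.le (ht.2.trans hlt) ht.2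
  exact (hzc.congr' heq).not_tendsto (Metric.disjoint_nhds_cobounded _) hlim

/-- The equation is autonomous: the shifted curve is a solution that diverges at `T - t`. -/
theorem IsSolutionOn.tmax_eq_sub {n : ℕ} {f : (Fin n → ℝ) → (Fin n → ℝ)} (hf : ContDiff ℝ 1 f)
    {y : ℝ → Fin n → ℝ} {T : ℝ} (hy : IsSolutionOn f y T)
    (hlim : Tendsto y (𝓝[<] T) (Bornology.cobounded (Fin n → ℝ))) {t : ℝ} (ht : t ∈ Ico 0 T) :
    tmax f (y t) = ENNReal.ofReal (T - t) := by
  have hsol : IsSolutionOn f (fun s => y (s + t)) (T - t) := by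
    intro s hs
    have h1 : s + t ∈ Ico 0 T := ⟨by linarith [hs.1, ht.1], by linarith [hs.2]⟩
    have h2 : HasDerivWithinAt (fun s : ℝ => s + t) 1 (Ico 0 (T - t)) s :=
      ((hasDerivAt_id s).add_const t).hasDerivWithinAt
    have hm : MapsTo (fun s : ℝ => s + t) (Ico 0 (T - t)) (Ico 0 T) := fun r hr =>
      ⟨by linarith [hr.1, ht.1], by linarith [hr.2]⟩
    have h3 := HasDerivWithinAt.scomp s (hy (s + t) h1) h2 hm
    rwa [one_smul] at h3
  have hlim' : Tendsto (fun s => y (s + t)) (𝓝[<] (T - t)) (Bornology.cobounded (Fin n → ℝ)) := by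
    refine hlim.comp (tendsto_nhdsWithin_iff.2 ⟨?_, ?_⟩)
    · have : Tendsto (fun s : ℝ => s + t) (𝓝 (T - t)) (𝓝 (T - t + t)) := by
        exact (continuous_add_const t).tendsto _
      rw [sub_add_cancel] at this
      exact this.mono_left nhdsWithin_le_nhds
    · filter_upwards [self_mem_nhdsWithin] with s hs
      have : s < T - t := hs
      exact mem_Iio.2 (by linarith)
  have := hsol.tmax_eq hf (sub_pos.2 ht.2) hlim'
  simpa using this

/-- Change of time: a curve `Y` with `Y' = σ f(Y)` on `[0, ∞)`, where `σ > 0` is integrable,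
becomes a solution of `y' = f(y)` on `[0, ∫ σ)` in the time variable `t = ∫₀^τ σ`. -/
theorem exists_isSolutionOn_of_timeChange {n : ℕ} {f : (Fin n → ℝ) → (Fin n → ℝ)}
    {Y : ℝ → Fin n → ℝ} {σ : ℝ → ℝ} (hσc : ContinuousOn σ (Ici 0)) (hσ : ∀ τ ∈ Ici (0 : ℝ), 0 < σ τ)
    (hσi : IntegrableOn σ (Ioi 0))
    (hY : ∀ τ ∈ Ici (0 : ℝ), HasDerivWithinAt Y (σ τ • f (Y τ)) (Ici 0) τ) :
    0 < ∫ τ in Ioi (0 : ℝ), σ τ ∧ ∃ s : ℝ → ℝ, s 0 = 0 ∧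
      (∀ t ∈ Ico 0 (∫ τ in Ioi (0 : ℝ), σ τ), 0 ≤ s t) ∧
      Tendsto s (𝓝[<] (∫ τ in Ioi (0 : ℝ), σ τ)) atTop ∧
      IsSolutionOn f (fun t => Y (s t)) (∫ τ in Ioi (0 : ℝ), σ τ) := by
  set T := ∫ τ in Ioi (0 : ℝ), σ τ with hT
  -- Extending `σ` by its value at `0` makes the density continuous and positive on the whole line,
  -- so its primitive is globally strictly increasing.
  set ρ : ℝ → ℝ := fun r => σ (max r 0) with hρ
  have hρc : Continuous ρ := hσc.comp_continuous (by fun_prop) fun r => le_max_right r 0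
  have hρpos : ∀ r, 0 < ρ r := fun r => hσ _ (le_max_right r 0)
  have hρσ : ∀ r, 0 ≤ r → ρ r = σ r := fun r hr => by simp [hρ, hr]
  have hρi : IntegrableOn ρ (Ioi 0) :=
    hσi.congr_fun (fun r hr => (hρσ r (le_of_lt hr)).symm) measurableSet_Ioi
  have hρT : ∫ τ in Ioi (0 : ℝ), ρ τ = T :=
    setIntegral_congr_fun measurableSet_Ioi fun r hr => hρσ r (le_of_lt hr)
  set A : ℝ → ℝ := fun τ => ∫ r in (0 : ℝ)..τ, ρ r with hA
  have hAd : ∀ τ, HasStrictDerivAt A (ρ τ) τ := fun τ => hρc.integral_hasStrictDerivAt 0 τ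
  have hAmono : StrictMono A := strictMono_of_hasDerivAt_pos (fun τ => (hAd τ).hasDerivAt) hρpos
  have hAc : Continuous A := continuous_iff_continuousAt.2 fun τ => (hAd τ).hasDerivAt.continuousAt
  have hA0 : A 0 = 0 := intervalIntegral.integral_same
  have hAT : Tendsto A atTop (𝓝 T) := by
    have := intervalIntegral_tendsto_integral_Ioi 0 hρi tendsto_id
    rwa [hρT] at this
  have hAlt : ∀ τ, A τ < T := fun τ =>
    (hAmono (lt_add_one τ)).trans_le (hAmono.monotone.ge_of_tendsto hAT _)
  have hsurj : ∀ t ∈ Ico 0 T, ∃ τ, 0 ≤ τ ∧ A τ = t := by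
    intro t ht
    obtain ⟨b, hb⟩ := (hAT.eventually (lt_mem_nhds ht.2)).exists
    obtain ⟨τ, hτ⟩ := mem_range_of_exists_le_of_exists_ge hAc ⟨0, hA0.trans_le ht.1⟩ ⟨b, hb.le⟩
    exact ⟨τ, hAmono.le_iff_le.1 (by rw [hA0, hτ]; exact ht.1), hτ⟩
  -- The new clock is `invFun A`. It is arbitrary off the range of `A`, but it is used only on `[0,
  -- T)`, which the range contains.
  have hinv : ∀ τ, Function.invFun A (A τ) = τ := Function.leftInverse_invFun hAmono.injective
  have hnonneg : ∀ t ∈ Ico 0 T, 0 ≤ Function.invFun A t := by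
    intro t ht
    obtain ⟨τ, h1, rfl⟩ := hsurj t ht
    rwa [hinv]
  refine ⟨hA0 ▸ hAlt 0, Function.invFun A, ?_, hnonneg, ?_, ?_⟩
  · conv_lhs => rw [← hA0, hinv]
  · refine tendsto_atTop.2 fun M => ?_
    have hM : max (A M) 0 < T := max_lt (hAlt M) (hA0 ▸ hAlt 0)
    filter_upwards [Ioo_mem_nhdsLT hM] with t ht
    obtain ⟨τ, -, rfl⟩ := hsurj t ⟨(le_max_right _ _).trans ht.1.le, ht.2⟩
    rw [hinv]
    exact (hAmono.lt_iff_lt.1 ((le_max_left _ _).trans_lt ht.1)).le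
  · intro t ht
    obtain ⟨τ, h1, rfl⟩ := hsurj t ht
    have hd : HasDerivWithinAt (Function.invFun A) (ρ τ)⁻¹ (Ico 0 T) (A τ) :=
      ((hAd τ).to_local_left_inverse (hρpos τ).ne'
        (Eventually.of_forall hinv)).hasDerivAt.hasDerivWithinAt
    have hy : HasDerivWithinAt Y (σ τ • f (Y τ)) (Ici 0) (Function.invFun A (A τ)) := by
      rw [hinv]; exact hY τ h1
    have := HasDerivWithinAt.scomp (A τ) hy hd hnonneg
    rw [hρσ τ h1, smul_smul, inv_mul_cancel₀ (hσ τ h1).ne', one_smul] at this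
    simp only [hinv]
    exact this

/-! ### Bounds from asymptotic quasi-homogeneity -/

theorem dil_dil {n : ℕ} (α : Fin n → ℕ) (s r : ℝ) (x : Fin n → ℝ) :
    dil α s (dil α r x) = dil α (s * r) x := by
  ext j; simp [dil, mul_pow, mul_assoc]

/-- Every nonzero vector is a dilation of a unit vector, with control of the dilation factor. -/
theorem exists_dil_sphere {n : ℕ} {α : Fin n → ℕ} (hα : ∀ i, 1 ≤ α i) {v : Fin n → ℝ} {δ R : ℝ}
    (hδ : 0 < δ) (hR1 : 1 ≤ R) (hv : δ ≤ ∑ i, v i ^ 2) (hvR : ∑ i, v i ^ 2 ≤ R) :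
    ∃ q : ℝ, R⁻¹ ≤ q ∧ q ≤ max 1 δ⁻¹ ∧ ∑ i, dil α q v i ^ 2 = 1 := by
  set Q := max 1 δ⁻¹ with hQ
  have hQ1 : 1 ≤ Q := le_max_left _ _
  have hQδ : 1 ≤ Q * δ := by
    calc 1 = δ⁻¹ * δ := (inv_mul_cancel₀ hδ.ne').symm
      _ ≤ Q * δ := mul_le_mul_of_nonneg_right (le_max_right _ _) hδ.le
  -- Since all weights are at least one, dilation by `Q ≥ 1` multiplies the squared length by at
  -- least `Q²`, and `Q² δ ≥ 1`; the intermediate value theorem on `[0, Q]` gives `q`.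
  have hcont : ContinuousOn (fun q : ℝ => ∑ i, dil α q v i ^ 2) (Icc 0 Q) := by
    unfold dil; fun_prop
  have h0 : ∑ i, dil α 0 v i ^ 2 = 0 :=
    Finset.sum_eq_zero fun i _ => by simp [dil, (Nat.one_le_iff_ne_zero.1 (hα i))]
  have hQv : 1 ≤ ∑ i, dil α Q v i ^ 2 := by
    calc 1 ≤ Q * δ := hQδ
      _ ≤ Q ^ 2 * δ := by nlinarith
      _ ≤ Q ^ 2 * ∑ i, v i ^ 2 := by gcongr
      _ = ∑ i, Q ^ 2 * v i ^ 2 := Finset.mul_sum _ _ _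
      _ ≤ ∑ i, dil α Q v i ^ 2 := by
          refine Finset.sum_le_sum fun i _ => ?_
          rw [dil, mul_pow]
          gcongr
          exact le_self_pow₀ hQ1 (Nat.one_le_iff_ne_zero.1 (hα i))
  obtain ⟨q, hq, hq1⟩ := intermediate_value_Icc (zero_le_one.trans hQ1) hcont
    (show (1 : ℝ) ∈ Icc _ _ from ⟨by simp only [h0]; exact zero_le_one, hQv⟩)
  refine ⟨q, ?_, hq.2, hq1⟩
  rcases le_total 1 q with h | h
  · exact (inv_le_one_of_one_le₀ hR1).trans h
  -- For `q ≤ 1` the dilation shrinks the squared length at least by `q²`, whence `1 ≤ q² R ≤ q R`.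
  · have : 1 ≤ q ^ 2 * R := by
      calc (1 : ℝ) = ∑ i, dil α q v i ^ 2 := hq1.symm
        _ ≤ ∑ i, q ^ 2 * v i ^ 2 := by
            refine Finset.sum_le_sum fun i _ => ?_
            rw [dil, mul_pow]
            have : q ^ α i ≤ q := pow_le_of_le_one hq.1 h (Nat.one_le_iff_ne_zero.1 (hα i))
            have h' : 0 ≤ q ^ α i := pow_nonneg hq.1 _
            gcongr
        _ = q ^ 2 * ∑ i, v i ^ 2 := (Finset.mul_sum _ _ _).symm
        _ ≤ q ^ 2 * R := by gcongr
    rw [inv_le_iff_one_le_mul₀ (by linarith)]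
    nlinarith [hq.1]

theorem isCompact_unitSphere (n : ℕ) : IsCompact {x : Fin n → ℝ | ∑ i, x i ^ 2 = 1} := by
  refine Metric.isCompact_of_isClosed_isBounded
    (isClosed_eq (by fun_prop) continuous_const) ?_
  refine (Metric.isBounded_closedBall (x := (0 : Fin n → ℝ)) (r := 1)).subset fun x hx => ?_
  rw [mem_closedBall_zero_iff, pi_norm_le_iff_of_nonneg zero_le_one]
  intro i
  rw [Real.norm_eq_abs, ← sq_le_one_iff_abs_le_one, ← (hx : ∑ i, x i ^ 2 = 1)]
  exact Finset.single_le_sum (f := fun i => x i ^ 2) (fun i _ => sq_nonneg _) (Finset.mem_univ i)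

/-- Uniformity on the sphere extends to a shell: write `v` as a dilation of a unit vector `w` by
`1/q`, with `q` in a compact subset of `(0, ∞)`, and apply the limit at scale `s/q`. -/
theorem IsAsympQuasiHomogeneous.exists_bound {n : ℕ} {α : Fin n → ℕ} {k : ℕ}
    {f : (Fin n → ℝ) → (Fin n → ℝ)} (hα : ∀ i, 1 ≤ α i) (hf : IsAsympQuasiHomogeneous α k f)
    {δ R : ℝ} (hδ : 0 < δ) (hR1 : 1 ≤ R) (j : Fin n) :
    ∃ s₀ K : ℝ, ∀ s ≥ s₀, ∀ v : Fin n → ℝ, δ ≤ ∑ i, v i ^ 2 → ∑ i, v i ^ 2 ≤ R →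
      |f (dil α s v) j / s ^ (k + α j)| ≤ K := by
  obtain ⟨-, fα, hq, hlim⟩ := hf
  obtain ⟨M, hM⟩ := (isCompact_unitSphere n).exists_bound_of_continuousOn
    (hq j).1.continuous.continuousOn
  have hlim' := Metric.tendstoUniformlyOn_iff.1 (hlim j) 1 one_pos
  obtain ⟨s₁, hs₁⟩ := eventually_atTop.1 hlim'
  set Q := max 1 δ⁻¹ with hQ
  have hQ0 : 0 < Q := lt_of_lt_of_le one_pos (le_max_left _ _)
  -- The threshold ensures `s/q ≥ s₁`, and the power of `R` pays for replacing `s` by `s/q` in the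
  -- denominator.
  refine ⟨max 1 (s₁ * Q), R ^ (k + α j) * (1 + M), fun s hs v hv hvR => ?_⟩
  have hs0 : 0 < s := one_pos.trans_le ((le_max_left _ _).trans hs)
  obtain ⟨q, hqR, hqQ, hq1⟩ := exists_dil_sphere hα hδ hR1 hv hvR
  have hq0 : 0 < q := (inv_pos.2 (one_pos.trans_le hR1)).trans_le hqR
  set w := dil α q v with hw
  have hv' : dil α s v = dil α (s / q) w := by
    rw [hw, dil_dil, div_mul_cancel₀ _ hq0.ne']
  have hsq : s₁ ≤ s / q := by
    rw [le_div_iff₀ hq0]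
    rcases le_total 0 s₁ with h | h
    · exact (mul_le_mul_of_nonneg_left hqQ h).trans ((le_max_right _ _).trans hs)
    · exact (mul_nonpos_of_nonpos_of_nonneg h hq0.le).trans hs0.le
  have hsq0 : 0 < s / q := div_pos hs0 hq0
  have h1 := hs₁ (s / q) hsq w hq1
  rw [Real.dist_eq, zero_sub, abs_neg, sub_div, mul_div_cancel_left₀ _ (pow_pos hsq0 _).ne'] at h1
  have h2 := hM w hq1
  rw [Real.norm_eq_abs] at h2
  have h3 : |f (dil α (s / q) w) j / (s / q) ^ (k + α j)| ≤ 1 + M := by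
    calc _ = |(f (dil α (s / q) w) j / (s / q) ^ (k + α j) - fα w j) + fα w j| := by ring_nf
      _ ≤ _ := (abs_add_le _ _).trans (add_le_add h1.le h2)
  have h4 : q⁻¹ ≤ R := inv_le_of_inv_le₀ (one_pos.trans_le hR1) hqR
  rw [hv']
  calc |f (dil α (s / q) w) j / s ^ (k + α j)|
      = q⁻¹ ^ (k + α j) * |f (dil α (s / q) w) j / (s / q) ^ (k + α j)| := by
        rw [← abs_of_pos (pow_pos (inv_pos.2 hq0) (k + α j)), ← abs_mul]
        congr 1
        rw [div_pow, inv_pow]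
        field_simp
    _ ≤ R ^ (k + α j) * (1 + M) := by gcongr

/-- Boundedness of the rescaled field along a family of points approaching infinity. -/
theorem IsAsympQuasiHomogeneous.eventually_bounded {n : ℕ} {α : Fin n → ℕ} {k : ℕ}
    {f : (Fin n → ℝ) → (Fin n → ℝ)} (hα : ∀ i, 1 ≤ α i) (hf : IsAsympQuasiHomogeneous α k f)
    {X : Type*} {l : Filter X} {κ : X → ℝ} {v : X → Fin n → ℝ} {v₀ : Fin n → ℝ} (hv₀ : v₀ ≠ 0)
    (hκ : Tendsto κ l atTop) (hv : Tendsto v l (𝓝 v₀)) (j : Fin n) :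
    ∃ K : ℝ, ∀ᶠ x in l, |f (dil α (κ x) (v x)) j / κ x ^ (k + α j)| ≤ K := by
  set N : (Fin n → ℝ) → ℝ := fun v => ∑ i, v i ^ 2 with hN
  have hNc : Continuous N := by fun_prop
  have hN0 : 0 < N v₀ := by
    obtain ⟨i, hi⟩ := Function.ne_iff.1 hv₀
    exact Finset.sum_pos' (fun i _ => sq_nonneg _) ⟨i, Finset.mem_univ i, sq_pos_of_ne_zero hi⟩
  obtain ⟨s₀, K, hK⟩ := hf.exists_bound hα (half_pos hN0) (le_max_left 1 (N v₀ + 1)) j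
  have hNv := (hNc.tendsto v₀).comp hv
  refine ⟨K, ?_⟩
  filter_upwards [hκ.eventually_ge_atTop s₀, hNv.eventually (lt_mem_nhds (half_lt_self hN0)),
    hNv.eventually (gt_mem_nhds (lt_add_one (N v₀)))] with x h1 h2 h3
  exact hK _ h1 _ h2.le (h3.le.trans (le_max_right _ _))

/-- Some coordinate of `v₀` is nonzero, and the dilation multiplies it by `κ ^ α j ≥ κ` once `κ ≥
1`. -/
theorem tendsto_dil_cobounded {n : ℕ} {α : Fin n → ℕ} (hα : ∀ i, 1 ≤ α i)
    {X : Type*} {l : Filter X} {κ : X → ℝ} {v : X → Fin n → ℝ} {v₀ : Fin n → ℝ} (hv₀ : v₀ ≠ 0)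
    (hκ : Tendsto κ l atTop) (hv : Tendsto v l (𝓝 v₀)) :
    Tendsto (fun x => dil α (κ x) (v x)) l (Bornology.cobounded (Fin n → ℝ)) := by
  obtain ⟨j, hj⟩ := Function.ne_iff.1 hv₀
  rw [← tendsto_norm_atTop_iff_cobounded]
  have h1 : Tendsto (fun x => κ x * |v x j|) l atTop :=
    hκ.atTop_mul_pos (abs_pos.2 hj) ((tendsto_pi_nhds.1 hv j).abs)
  refine tendsto_atTop_mono' l ?_ h1
  filter_upwards [hκ.eventually_ge_atTop 1] with x hx
  refine le_trans ?_ (norm_le_pi_norm _ j)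
  rw [Real.norm_eq_abs, dil, abs_mul, abs_of_nonneg (pow_nonneg (zero_le_one.trans hx) _)]
  gcongr
  exact le_self_pow₀ hx (Nat.one_le_iff_ne_zero.1 (hα j))

/-! ### A barrier argument -/

/-- A function with `u' = -u H`, where `H` is bounded whenever `u` approaches zero, stays
positive. -/
theorem pos_of_hasDerivWithinAt_neg_mul {u H : ℝ → ℝ} (hu : ContinuousOn u (Ici 0)) (h0 : 0 < u 0)
    (hd : ∀ τ, 0 ≤ τ → 0 < u τ → HasDerivWithinAt u (-(u τ * H τ)) (Ici 0) τ)
    (hb : ∀ τ₀, 0 < τ₀ → u τ₀ = 0 → (∀ τ ∈ Ico 0 τ₀, 0 < u τ) →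
      ∃ K, ∀ᶠ τ in 𝓝[<] τ₀, |H τ| ≤ K) : ∀ τ, 0 ≤ τ → 0 < u τ := by
  by_contra! hcon
  obtain ⟨τ₁, hτ₁, hu₁⟩ := hcon
  have hcl : IsCompact (Icc 0 τ₁ ∩ u ⁻¹' Iic 0) :=
    isCompact_Icc.of_isClosed_subset
      ((hu.mono Icc_subset_Ici_self).preimage_isClosed_of_isClosed isClosed_Icc isClosed_Iic)
      inter_subset_left
  -- `τ₀` is the first time at which `u` is not positive.
  obtain ⟨τ₀, hτ₀, hmin⟩ := hcl.exists_isLeast ⟨τ₁, ⟨hτ₁, le_rfl⟩, hu₁⟩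
  have hpos : ∀ τ ∈ Ico 0 τ₀, 0 < u τ := by
    intro τ hτ
    by_contra! h
    exact (hmin ⟨⟨hτ.1, hτ.2.le.trans hτ₀.1.2⟩, h⟩).not_gt hτ.2
  have hτ₀pos : 0 < τ₀ := by
    rcases hτ₀.1.1.eq_or_lt with h | h
    · have := hτ₀.2
      rw [← h] at this
      exact absurd h0 (not_lt.2 this)
    · exact h
  have hcat : ContinuousAt u τ₀ := hu.continuousAt (Ici_mem_nhds hτ₀pos)
  have hu0 : u τ₀ = 0 := by
    refine le_antisymm hτ₀.2 ?_
    refine ge_of_tendsto (hcat.tendsto.mono_left (nhdsWithin_le_nhds (s := Iio τ₀))) ?_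
    filter_upwards [Ioo_mem_nhdsLT hτ₀pos] with τ hτ
    exact (hpos τ ⟨hτ.1.le, hτ.2⟩).le
  obtain ⟨K, hK⟩ := hb τ₀ hτ₀pos hu0 hpos
  obtain ⟨τ₂, hτ₂, hsub⟩ := mem_nhdsLT_iff_exists_Ico_subset.1
    (inter_mem hK (Ioo_mem_nhdsLT hτ₀pos))
  have hτ₂' : τ₂ < τ₀ := hτ₂
  have hτ₂pos : 0 < τ₂ := (hsub ⟨le_rfl, hτ₂'⟩).2.1
  -- With the integrating factor `e^{Kτ}` the function is nondecreasing just before `τ₀`, so it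
  -- cannot fall from a positive value to zero.
  have hmono : MonotoneOn (fun τ => u τ * Real.exp (K * τ)) (Icc τ₂ τ₀) := by
    refine monotoneOn_of_hasDerivWithinAt_nonneg (convex_Icc _ _)
      (f' := fun τ => -(u τ * H τ) * Real.exp (K * τ) + u τ * (Real.exp (K * τ) * K)) ?_ ?_ ?_
    · exact (hu.mono fun τ hτ => hτ₂pos.le.trans hτ.1).mul (by fun_prop)
    · intro τ hτ
      rw [interior_Icc] at hτ ⊢
      have h1 : 0 < τ := hτ₂pos.trans hτ.1
      have h2 := (hd τ h1.le (hpos τ ⟨h1.le, hτ.2⟩)).hasDerivAt (Ici_mem_nhds h1)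
      have h3 : HasDerivAt (fun τ => Real.exp (K * τ)) (Real.exp (K * τ) * K) τ := by
        simpa using ((hasDerivAt_id τ).const_mul K).exp
      exact (h2.mul h3).hasDerivWithinAt
    · intro τ hτ
      rw [interior_Icc] at hτ
      have h1 : 0 < τ := hτ₂pos.trans hτ.1
      have h2 := hpos τ ⟨h1.le, hτ.2⟩
      have h3 : H τ ≤ K := (le_abs_self _).trans (hsub ⟨hτ.1.le, hτ.2⟩).1
      have : -(u τ * H τ) * Real.exp (K * τ) + u τ * (Real.exp (K * τ) * K) =
          u τ * Real.exp (K * τ) * (K - H τ) := by ring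
      rw [this]
      exact mul_nonneg (mul_pos h2 (Real.exp_pos _)).le (sub_nonneg.2 h3)
  have := hmono (left_mem_Icc.2 hτ₂'.le) (right_mem_Icc.2 hτ₂'.le) hτ₂'.le
  simp only [hu0, zero_mul] at this
  exact absurd (mul_pos (hpos τ₂ ⟨hτ₂pos.le, hτ₂'⟩) (Real.exp_pos (K * τ₂))) (not_lt.2 this)

/-! ### Geometry of the compactifications -/

theorem pnorm_pow {n : ℕ} {β : Fin n → ℕ} {c : ℕ} (hc : 1 ≤ c) (x : Fin n → ℝ) :
    pnorm β c x ^ (2 * c) = ∑ i, x i ^ (2 * β i) := by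
  have h0 : 0 ≤ ∑ i, x i ^ (2 * β i) :=
    Finset.sum_nonneg fun i _ => by rw [pow_mul]; positivity
  have hc' : (2 * c : ℝ) ≠ 0 := by positivity
  rw [pnorm, ← Real.rpow_natCast, ← Real.rpow_mul h0]
  push_cast
  rw [one_div_mul_cancel hc', Real.rpow_one]

theorem pnorm_nonneg {n : ℕ} (β : Fin n → ℕ) (c : ℕ) (x : Fin n → ℝ) : 0 ≤ pnorm β c x :=
  Real.rpow_nonneg (Finset.sum_nonneg fun i _ => by rw [pow_mul]; positivity) _

theorem sum_dil_pow {n : ℕ} {α β : Fin n → ℕ} {c : ℕ} (hαβ : ∀ j, α j * β j = c) (s : ℝ)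
    (x : Fin n → ℝ) :
    ∑ i, dil α s x i ^ (2 * β i) = s ^ (2 * c) * ∑ i, x i ^ (2 * β i) := by
  rw [Finset.mul_sum]
  refine Finset.sum_congr rfl fun i _ => ?_
  rw [dil, mul_pow, ← pow_mul, ← hαβ i]
  ring_nf

theorem kappaRoot_pos {c : ℕ} (hc : 1 ≤ c) (R : ℝ) : 0 < kappaRoot c R :=
  one_pos.trans_le (kappaRoot_spec hc R).1

theorem sign_mul_self (σ : ℤˣ) : ((σ : ℤ) : ℝ) * ((σ : ℤ) : ℝ) = 1 := by
  exact_mod_cast Int.units_coe_mul_self σ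

theorem rpow_neg_div_natCast_pow {s : ℝ} (hs : 0 < s) {N : ℕ} (hN : N ≠ 0) :
    (s ^ (-(1 : ℝ) / N)) ^ N = s⁻¹ := by
  have : (N : ℝ) ≠ 0 := by exact_mod_cast hN
  rw [← Real.rpow_natCast, ← Real.rpow_mul hs.le, div_mul_cancel₀ _ this, Real.rpow_neg_one]

theorem inv_pow_rpow_neg_div {s : ℝ} (hs : 0 < s) {N : ℕ} (hN : N ≠ 0) :
    ((s⁻¹) ^ N) ^ (-(1 : ℝ) / N) = s := by
  have : (N : ℝ) ≠ 0 := by exact_mod_cast hN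
  rw [← Real.rpow_natCast, ← Real.rpow_mul (inv_pos.2 hs).le, mul_div_cancel₀ _ this,
    Real.rpow_neg_one, inv_inv]

namespace Compactification

variable {n : ℕ} {α : Fin n → ℕ} {k : ℕ} {f : (Fin n → ℝ) → (Fin n → ℝ)} {C : Compactification n}

/-- A polynomial function that is positive on the domain and vanishes on the horizon. -/
def barrier : Compactification n → (Fin n → ℝ) → ℝ
  | directional i _ => fun z => z i
  | poincare β _ => fun x => 1 - ∑ i, x i ^ (2 * β i)
  | parabolic β _ => fun x => 1 - ∑ i, x i ^ (2 * β i)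

/-- The point whose dilation by `kappa` is `Tinv`. -/
def shape : Compactification n → (Fin n → ℝ) → (Fin n → ℝ)
  | directional i σ => fun z => Function.update z i ((σ : ℤ) : ℝ)
  | poincare _ _ => fun x => x
  | parabolic _ _ => fun x => x

/-- The factor `w` of the parabolic type, and `1` otherwise. -/
noncomputable def weight : Compactification n → (Fin n → ℝ) → ℝ
  | directional _ _ => fun _ => 1
  | poincare _ _ => fun _ => 1
  | parabolic β c => fun x => 1 - (2 * c - 1) / (2 * c) * (1 - ∑ i, x i ^ (2 * β i))

/-- The logarithmic derivative of `kappa` along the desingularized field. -/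
noncomputable def gain (α : Fin n → ℕ) (k : ℕ) (f : (Fin n → ℝ) → (Fin n → ℝ)) :
    Compactification n → (Fin n → ℝ) → ℝ
  | directional i σ => fun z => ((σ : ℤ) : ℝ) * ((directional i σ).ftilde α k f z i / α i)
  | poincare β c => fun x => ∑ j, x j ^ (2 * β j - 1) / α j * (poincare β c).ftilde α k f x j
  | parabolic β c => fun x => ∑ j, x j ^ (2 * β j - 1) / α j * (parabolic β c).ftilde α k f x j

theorem Tinv_eq (x : Fin n → ℝ) : C.Tinv α x = dil α (C.kappa x) (C.shape x) := by
  cases C <;> rfl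

theorem continuous_barrier : Continuous C.barrier := by
  cases C <;> simp only [barrier] <;> fun_prop

theorem continuous_shape : Continuous C.shape := by
  cases C with
  | directional i σ => exact continuous_id.update i continuous_const
  | poincare β c => exact continuous_id
  | parabolic β c => exact continuous_id

theorem mem_domain_iff (hC : C.Admissible α k) {x : Fin n → ℝ} :
    x ∈ C.domain ↔ 0 < C.barrier x := by
  cases C with
  | directional i σ => rfl
  | poincare β c =>
    rw [barrier, sub_pos, ← pnorm_pow hC.1, pow_lt_one_iff_of_nonneg (pnorm_nonneg _ _ _)
      (by have := hC.1; omega)]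
    rfl
  | parabolic β c =>
    rw [barrier, sub_pos, ← pnorm_pow hC.1, pow_lt_one_iff_of_nonneg (pnorm_nonneg _ _ _)
      (by have := hC.1; omega)]
    rfl

theorem mem_horizon_iff (hC : C.Admissible α k) {x : Fin n → ℝ} :
    x ∈ C.horizon ↔ C.barrier x = 0 := by
  cases C with
  | directional i σ => rfl
  | poincare β c =>
    rw [barrier, sub_eq_zero, eq_comm, ← pnorm_pow hC.1, pow_eq_one_iff_of_nonneg
      (pnorm_nonneg _ _ _) (by have := hC.1; omega)]
    rfl
  | parabolic β c =>
    rw [barrier, sub_eq_zero, eq_comm, ← pnorm_pow hC.1, pow_eq_one_iff_of_nonneg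
      (pnorm_nonneg _ _ _) (by have := hC.1; omega)]
    rfl

theorem isOpen_domain (hC : C.Admissible α k) : IsOpen C.domain := by
  have : C.domain = C.barrier ⁻¹' Ioi 0 := by ext x; exact mem_domain_iff hC
  rw [this]
  exact isOpen_Ioi.preimage continuous_barrier

/-- `kappa` as a function of the barrier. -/
noncomputable def kappaOf : Compactification n → ℝ → ℝ
  | directional _ _ => fun u => u⁻¹
  | poincare _ c => fun u => u ^ (-(1 : ℝ) / (2 * c))
  | parabolic _ _ => fun u => u⁻¹

theorem kappa_eq (hC : C.Admissible α k) (x : Fin n → ℝ) :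
    C.kappa x = C.kappaOf (C.barrier x) := by
  cases C with
  | directional i σ => rfl
  | poincare β c => simp only [kappa, kappaOf, barrier, pnorm_pow hC.1]
  | parabolic β c => simp only [kappa, kappaOf, barrier, pnorm_pow hC.1]

theorem kappaOf_pos {u : ℝ} (hu : 0 < u) : 0 < C.kappaOf u := by
  cases C with
  | directional i σ => exact inv_pos.2 hu
  | poincare β c => exact Real.rpow_pos_of_pos hu _
  | parabolic β c => exact inv_pos.2 hu

theorem continuousAt_kappaOf {u : ℝ} (hu : 0 < u) : ContinuousAt C.kappaOf u := by
  cases C with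
  | directional i σ => exact continuousAt_inv₀ hu.ne'
  | poincare β c => exact Real.continuousAt_rpow_const _ _ (Or.inl hu.ne')
  | parabolic β c => exact continuousAt_inv₀ hu.ne'

theorem tendsto_kappaOf (hC : C.Admissible α k) : Tendsto C.kappaOf (𝓝[>] 0) atTop := by
  cases C with
  | directional i σ => exact tendsto_inv_nhdsGT_zero
  | poincare β c =>
    have hc : (0 : ℝ) < 2 * c := by have := hC.1; positivity
    exact tendsto_rpow_neg_nhdsGT_zero (div_neg_of_neg_of_pos (by norm_num) hc)
  | parabolic β c => exact tendsto_inv_nhdsGT_zero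

theorem kappa_pos (hC : C.Admissible α k) {x : Fin n → ℝ} (hx : x ∈ C.domain) :
    0 < C.kappa x := by
  rw [kappa_eq hC]
  exact kappaOf_pos ((mem_domain_iff hC).1 hx)

theorem tendsto_kappa (hC : C.Admissible α k) {x₀ : Fin n → ℝ} (hx₀ : x₀ ∈ C.horizon) :
    Tendsto C.kappa (𝓝[C.domain] x₀) atTop := by
  have h : Tendsto C.barrier (𝓝[C.domain] x₀) (𝓝[>] 0) := by
    refine tendsto_nhdsWithin_iff.2 ⟨?_, ?_⟩
    · rw [← (mem_horizon_iff hC).1 hx₀]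
      exact continuous_barrier.continuousWithinAt
    · filter_upwards [self_mem_nhdsWithin] with x hx using (mem_domain_iff hC).1 hx
  exact ((tendsto_kappaOf hC).comp h).congr fun x => (kappa_eq hC x).symm

/-- In a directional chart coordinate `i` of the shape is `σ`; in the global cases `p = 1` excludes
the origin, since every `β j ≥ 1`. -/
theorem shape_ne_zero (hC : C.Admissible α k) {x : Fin n → ℝ} (hx : x ∈ C.horizon) :
    C.shape x ≠ 0 := by
  have key : ∀ β : Fin n → ℕ, (∀ j, 1 ≤ β j) → 1 - ∑ i, x i ^ (2 * β i) = 0 → x ≠ 0 := by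
    rintro β hβ h rfl
    rw [Finset.sum_eq_zero] at h
    · norm_num at h
    · intro i _
      have := hβ i
      exact zero_pow (by omega)
  have hβ : ∀ (β : Fin n → ℕ) (c : ℕ), 1 ≤ c → (∀ j, α j * β j = c) → ∀ j, 1 ≤ β j := by
    intro β c hc h j
    by_contra h0
    have : β j = 0 := by omega
    have h' := h j
    rw [this, mul_zero] at h'
    omega
  rw [mem_horizon_iff hC] at hx
  cases C with
  | directional i σ =>
    intro h
    have := congrFun h i
    simp [shape] at this
  | poincare β c => exact key β (hβ β c hC.1 hC.2.1) hx
  | parabolic β c => exact key β (hβ β c hC.1 hC.2) hx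

theorem tendsto_Tinv_cobounded (hα : ∀ i, 1 ≤ α i) (hC : C.Admissible α k) {x₀ : Fin n → ℝ}
    (hx₀ : x₀ ∈ C.horizon) :
    Tendsto (C.Tinv α) (𝓝[C.domain] x₀) (Bornology.cobounded (Fin n → ℝ)) := by
  refine (tendsto_dil_cobounded hα (shape_ne_zero hC hx₀) (tendsto_kappa hC hx₀)
    continuous_shape.continuousWithinAt).congr fun x => (Tinv_eq x).symm

theorem continuousAt_Tinv (hC : C.Admissible α k) {x : Fin n → ℝ} (hx : x ∈ C.domain) :
    ContinuousAt (C.Tinv α) x := by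
  have h1 : ContinuousAt C.kappa x := by
    have : C.kappa = C.kappaOf ∘ C.barrier := funext (kappa_eq hC)
    rw [this]
    exact (continuousAt_kappaOf ((mem_domain_iff hC).1 hx)).comp continuous_barrier.continuousAt
  have h2 : C.Tinv α = fun x => dil α (C.kappa x) (C.shape x) := funext Tinv_eq
  rw [h2]
  refine continuousAt_pi.2 fun j => ?_
  exact (h1.pow _).mul ((continuous_apply j).comp continuous_shape).continuousAt

/-- Near the horizon `kappa` tends to infinity while the shape tends to a nonzero vector, so
`ftilde` is bounded; `gain` combines its components with continuous coefficients. -/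
theorem eventually_gain_bounded (hα : ∀ i, 1 ≤ α i) (hf : IsAsympQuasiHomogeneous α k f)
    (hC : C.Admissible α k) {x₀ : Fin n → ℝ} (hx₀ : x₀ ∈ C.horizon) :
    ∃ K, ∀ᶠ x in 𝓝[C.domain] x₀, |C.gain α k f x| ≤ K := by
  have hb : ∀ j, (𝓝[C.domain] x₀).IsBoundedUnder (· ≤ ·) fun x => ‖C.ftilde α k f x j‖ := by
    intro j
    obtain ⟨K, hK⟩ := hf.eventually_bounded hα (shape_ne_zero hC hx₀) (tendsto_kappa hC hx₀)
      continuous_shape.continuousWithinAt j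
    refine ⟨K, eventually_map.2 ?_⟩
    filter_upwards [hK] with x hx
    rwa [Real.norm_eq_abs, ftilde, Tinv_eq]
  have hb' : ∀ j, (fun x => C.ftilde α k f x j) =O[𝓝[C.domain] x₀] fun _ => (1 : ℝ) :=
    fun j => (Asymptotics.isBigO_one_iff ℝ).2 (hb j)
  have key : (C.gain α k f) =O[𝓝[C.domain] x₀] fun _ => (1 : ℝ) := by
    have aux : ∀ β : Fin n → ℕ, (fun x => ∑ j, x j ^ (2 * β j - 1) / α j * C.ftilde α k f x j)
        =O[𝓝[C.domain] x₀] fun _ => (1 : ℝ) := by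
      intro β
      refine Asymptotics.IsBigO.fun_sum fun j _ => ?_
      have h1 : (fun x : Fin n → ℝ => x j ^ (2 * β j - 1) / α j) =O[𝓝[C.domain] x₀]
          fun _ => (1 : ℝ) := by
        refine Tendsto.isBigO_one ℝ (c := x₀ j ^ (2 * β j - 1) / α j) ?_
        exact (Continuous.tendsto (by fun_prop) x₀).mono_left nhdsWithin_le_nhds
      simpa using h1.mul (hb' j)
    cases C with
    | directional i σ =>
      have := ((hb' i).const_mul_left ((σ : ℤ) : ℝ)).const_mul_left (α i : ℝ)⁻¹
      refine this.congr_left fun x => ?_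
      simp only [gain]; ring
    | poincare β c => exact aux β
    | parabolic β c => exact aux β
  obtain ⟨K, hK⟩ := (Asymptotics.isBigO_one_iff ℝ).1 key
  exact ⟨K, eventually_map.1 hK⟩

theorem weight_pos (hC : C.Admissible α k) (x : Fin n → ℝ) : 0 < C.weight x := by
  cases C with
  | directional i σ => exact one_pos
  | poincare β c => exact one_pos
  | parabolic β c =>
    have hc : (1 : ℝ) ≤ c := by exact_mod_cast hC.1
    have h1 : (2 * c - 1 : ℝ) / (2 * c) < 1 := by
      rw [div_lt_one (by linarith)]; linarith
    have h2 : (0 : ℝ) ≤ (2 * c - 1) / (2 * c) := div_nonneg (by linarith) (by linarith)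
    have h3 : 1 - ∑ i, x i ^ (2 * β i) ≤ 1 := by
      rw [sub_le_self_iff]
      exact Finset.sum_nonneg fun i _ => by rw [pow_mul]; positivity
    rw [weight, sub_pos]
    exact (mul_le_of_le_one_right h2 h3).trans_lt h1

/-- The weight in the denominators of the sum cancels against the outer factor. -/
theorem desing_parabolic {β : Fin n → ℕ} {c : ℕ} (hC : (parabolic β c).Admissible α k)
    (x : Fin n → ℝ) (j : Fin n) : (parabolic β c).desing α k f x j =
      (parabolic β c).weight x * (parabolic β c).ftilde α k f x j - α j * x j *
        ∑ i, x i ^ (2 * β i - 1) / α i * (parabolic β c).ftilde α k f x i := by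
  have hw := (weight_pos hC x).ne'
  simp only [desing, pnorm_pow hC.1]
  change weight (parabolic β c) x * (_ - _ * ∑ i, _ / (_ * weight (parabolic β c) x) * _) = _
  rw [mul_sub, mul_left_comm (weight _ _), Finset.mul_sum]
  congr 2
  refine Finset.sum_congr rfl fun i _ => ?_
  rw [div_mul_eq_div_div]
  field_simp

/-- The coefficient relating `gain` to the logarithmic derivative of the barrier. -/
noncomputable def gainCoeff : Compactification n → ℝ
  | directional _ _ => 1
  | poincare _ c => 2 * c
  | parabolic _ _ => 1

/-- The barrier divides its own derivative. In the global cases `α_j β_j = c` collapses the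
derivative to `-2c (w - p^{2c}) · gain`. Here `w - p^{2c}` is the barrier for `w = 1`, and the
barrier divided by `2c` for the parabolic weight, which explains `gainCoeff`. -/
theorem hasDerivWithinAt_barrier (hC : C.Admissible α k) {x : ℝ → Fin n → ℝ}
    {s : Set ℝ} {τ : ℝ} (hx : HasDerivWithinAt x (C.desing α k f (x τ)) s τ)
    (hτ : x τ ∈ C.domain) :
    HasDerivWithinAt (fun r => C.barrier (x r))
      (-(C.barrier (x τ) * (C.gainCoeff * C.gain α k f (x τ)))) s τ := by
  have hxj := hasDerivWithinAt_pi.1 hx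
  rw [mem_domain_iff hC] at hτ
  have hsum : ∀ (β : Fin n → ℕ) (c : ℕ), 1 ≤ c → (∀ j, α j * β j = c) → ∀ (w : ℝ)
      (ft : Fin n → ℝ), (∀ j, C.desing α k f (x τ) j = w * ft j - α j * x τ j *
        ∑ i, x τ i ^ (2 * β i - 1) / α i * ft i) →
      HasDerivWithinAt (fun r => 1 - ∑ i, x r i ^ (2 * β i))
        (-((1 - ∑ i, x τ i ^ (2 * β i) - (1 - w)) *
          (2 * c * ∑ i, x τ i ^ (2 * β i - 1) / α i * ft i))) s τ := by
    intro β c hc hαβ w ft hw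
    set G := ∑ i, x τ i ^ (2 * β i - 1) / α i * ft i with hG
    have h1 : HasDerivWithinAt (fun r => 1 - ∑ i, x r i ^ (2 * β i))
        (0 - ∑ i, (2 * β i : ℕ) * x τ i ^ (2 * β i - 1) * C.desing α k f (x τ) i) s τ :=
      (hasDerivWithinAt_const τ s 1).sub
        (HasDerivWithinAt.fun_sum fun i _ => (hxj i).pow (2 * β i))
    refine h1.congr_deriv ?_
    have h2 : ∀ i, ((2 * β i : ℕ) : ℝ) * x τ i ^ (2 * β i - 1) * C.desing α k f (x τ) i =
        2 * c * w * (x τ i ^ (2 * β i - 1) / α i * ft i) - 2 * c * G * x τ i ^ (2 * β i) := by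
      intro i
      have hcα : (c : ℝ) = α i * β i := by exact_mod_cast (hαβ i).symm
      have hne : (c : ℝ) ≠ 0 := by positivity
      have hα0 : (α i : ℝ) ≠ 0 := fun h => hne (by rw [hcα, h, zero_mul])
      have hβ0 : β i ≠ 0 := fun h => hne (by rw [hcα, h, Nat.cast_zero, mul_zero])
      have hp : x τ i ^ (2 * β i) = x τ i ^ (2 * β i - 1) * x τ i := by
        rw [← pow_succ]; congr 1; omega
      rw [hw i, hp, hcα]
      push_cast
      field_simp
    simp only [h2, Finset.sum_sub_distrib, ← Finset.mul_sum, ← hG]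
    ring
  cases C with
  | directional i σ =>
    refine (hxj i).congr_deriv ?_
    simp only [desing, barrier, gain, gainCoeff, if_true]
    ring
  | poincare β c =>
    refine (hsum β c hC.1 hC.2.1 1 ((poincare β c).ftilde α k f (x τ)) fun j => ?_).congr_deriv ?_
    · simp only [desing, one_mul]
    · simp only [barrier, gain, gainCoeff]; ring
  | parabolic β c =>
    have hc : (1 : ℝ) ≤ c := by exact_mod_cast hC.1
    refine (hsum β c hC.1 hC.2 ((parabolic β c).weight (x τ))
      ((parabolic β c).ftilde α k f (x τ)) (desing_parabolic hC (x τ))).congr_deriv ?_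
    simp only [barrier, gain, gainCoeff, weight]
    have : (c : ℝ) ≠ 0 := by positivity
    field_simp
    ring

end Compactification

/-! ### Time factor and conjugacy of the two flows -/

namespace Compactification

variable {n : ℕ} {α : Fin n → ℕ} {k : ℕ} {f : (Fin n → ℝ) → (Fin n → ℝ)} {C : Compactification n}

/-- The time change absorbs exactly the power `κ^k` by which `f` outgrows the dilation weights. In
the Poincaré case this needs `k / (2 * c)` to be an exact quotient. -/
theorem timeFactor_mul_kappa_pow (hC : C.Admissible α k) {x : Fin n → ℝ} (hx : x ∈ C.domain) :
    C.timeFactor k x * C.kappa x ^ k = C.weight x := by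
  rw [mem_domain_iff hC] at hx
  rw [kappa_eq hC]
  cases C with
  | directional i σ =>
    simp only [barrier] at hx
    simp only [timeFactor, kappaOf, barrier, weight]
    rw [inv_pow, mul_inv_cancel₀ (pow_pos hx k).ne']
  | poincare β c =>
    have hc : 2 * c ≠ 0 := by have := hC.1; omega
    obtain ⟨d, rfl⟩ := hC.2.2
    simp only [barrier] at hx
    simp only [timeFactor, kappaOf, barrier, weight, pnorm_pow hC.1]
    have h := rpow_neg_div_natCast_pow hx hc
    push_cast at h
    rw [Nat.mul_div_cancel_left d (Nat.pos_of_ne_zero hc), pow_mul, h, inv_pow,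
      mul_inv_cancel₀ (pow_pos hx d).ne']
  | parabolic β c =>
    simp only [barrier] at hx
    simp only [timeFactor, kappaOf, barrier, weight, pnorm_pow hC.1]
    rw [inv_pow, mul_assoc, mul_inv_cancel₀ (pow_pos hx k).ne', mul_one]

theorem timeFactor_pos (hC : C.Admissible α k) {x : Fin n → ℝ} (hx : x ∈ C.domain) :
    0 < C.timeFactor k x := by
  have h1 := pow_pos (kappa_pos hC hx) k
  exact pos_of_mul_pos_left (timeFactor_mul_kappa_pow hC hx ▸ weight_pos hC x) h1.le

/-- The exponent of the barrier is positive; in the Poincaré case because `2c` divides `k ≥ 1`. This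
removes the constant term from `S ∘ P`. -/
theorem timeFactor_eq_zero (hk : 1 ≤ k) (hC : C.Admissible α k) {x : Fin n → ℝ}
    (hx : x ∈ C.horizon) : C.timeFactor k x = 0 := by
  have hk' : k ≠ 0 := by omega
  rw [mem_horizon_iff hC] at hx
  cases C with
  | directional i σ =>
    simp only [barrier] at hx
    simp [timeFactor, hx, hk']
  | poincare β c =>
    simp only [barrier] at hx
    have hc : 0 < 2 * c := by have := hC.1; omega
    have : k / (2 * c) ≠ 0 := (Nat.div_pos (Nat.le_of_dvd hk hC.2.2) hc).ne'
    simp only [timeFactor, pnorm_pow hC.1, hx]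
    exact zero_pow this
  | parabolic β c =>
    simp only [barrier] at hx
    simp [timeFactor, pnorm_pow hC.1, hx, hk']

theorem exists_polynomial_timeFactor (hC : C.Admissible α k) :
    ∃ s : MvPolynomial (Fin n) ℝ, ∀ x, C.timeFactor k x = MvPolynomial.eval x s := by
  cases C with
  | directional i σ => exact ⟨MvPolynomial.X i ^ k, fun x => by simp [timeFactor]⟩
  | poincare β c =>
    exact ⟨(1 - ∑ i, MvPolynomial.X i ^ (2 * β i)) ^ (k / (2 * c)), fun x => by
      simp [timeFactor, pnorm_pow hC.1]⟩
  | parabolic β c =>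
    exact ⟨(1 - MvPolynomial.C ((2 * c - 1 : ℝ) / (2 * c)) *
      (1 - ∑ i, MvPolynomial.X i ^ (2 * β i))) * (1 - ∑ i, MvPolynomial.X i ^ (2 * β i)) ^ k,
      fun x => by simp [timeFactor, pnorm_pow hC.1]⟩

/-- `kappa` is the barrier to the power `-1/gainCoeff`, so its logarithmic derivative is `gain`. -/
theorem hasDerivWithinAt_kappa (hC : C.Admissible α k) {x : ℝ → Fin n → ℝ}
    {s : Set ℝ} {τ : ℝ} (hx : HasDerivWithinAt x (C.desing α k f (x τ)) s τ)
    (hτ : x τ ∈ C.domain) :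
    HasDerivWithinAt (fun r => C.kappa (x r)) (C.kappa (x τ) * C.gain α k f (x τ)) s τ := by
  have hb := hasDerivWithinAt_barrier hC hx hτ
  rw [mem_domain_iff hC] at hτ
  simp only [kappa_eq hC]
  have key : HasDerivAt C.kappaOf
      (-(C.kappaOf (C.barrier (x τ)) / (C.gainCoeff * C.barrier (x τ)))) (C.barrier (x τ)) := by
    have hinv : HasDerivAt (fun u : ℝ => u⁻¹)
        (-((C.barrier (x τ))⁻¹ / (1 * C.barrier (x τ)))) (C.barrier (x τ)) := by
      refine (hasDerivAt_inv hτ.ne').congr_deriv ?_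
      field_simp
    cases C with
    | directional i σ => exact hinv
    | poincare β c =>
      have hc : (c : ℝ) ≠ 0 := by have := hC.1; positivity
      refine (Real.hasDerivAt_rpow_const (Or.inl hτ.ne')).congr_deriv ?_
      rw [Real.rpow_sub_one hτ.ne']
      simp only [kappaOf, gainCoeff]
      field_simp
    | parabolic β c => exact hinv
  refine (key.comp_hasDerivWithinAt τ hb).congr_deriv ?_
  have hg : C.gainCoeff ≠ 0 := by
    cases C with
    | directional i σ => exact one_ne_zero
    | poincare β c =>
      have : (c : ℝ) ≠ 0 := by have := hC.1; positivity
      simpa [gainCoeff] using this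
    | parabolic β c => exact one_ne_zero
  have := hτ.ne'
  field_simp

/-- One formula for all three types. In a directional chart the coordinate `i` of the shape is
constant, and the right side vanishes there because `σ² = 1`. -/
theorem hasDerivWithinAt_shape (hα : ∀ i, 1 ≤ α i) (hC : C.Admissible α k) {x : ℝ → Fin n → ℝ}
    {s : Set ℝ} {τ : ℝ} (hx : HasDerivWithinAt x (C.desing α k f (x τ)) s τ) (j : Fin n) :
    HasDerivWithinAt (fun r => C.shape (x r) j)
      (C.weight (x τ) * C.ftilde α k f (x τ) j -
        α j * C.gain α k f (x τ) * C.shape (x τ) j) s τ := by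
  have hxj := hasDerivWithinAt_pi.1 hx
  cases C with
  | directional i σ =>
    have hσ := sign_mul_self σ
    by_cases hj : j = i
    · subst hj
      simp only [shape, Function.update_self, weight, gain]
      refine (hasDerivWithinAt_const τ s _).congr_deriv ?_
      have h0 : (α j : ℝ) ≠ 0 := by have := hα j; positivity
      field_simp
      rw [sq, hσ, sub_self, mul_zero]
    · simp only [shape, Function.update_of_ne hj, weight, gain]
      refine (hxj j).congr_deriv ?_
      simp only [desing, if_neg hj]
      ring
  | poincare β c =>
    refine (hxj j).congr_deriv ?_
    simp only [desing, weight, gain, shape]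
    ring
  | parabolic β c =>
    refine (hxj j).congr_deriv ?_
    rw [desing_parabolic hC]
    simp only [gain, shape]
    ring

/-- The inverse compactification maps the desingularized flow to the original one, up to the time
factor. -/
theorem hasDerivWithinAt_Tinv (hα : ∀ i, 1 ≤ α i) (hC : C.Admissible α k) {x : ℝ → Fin n → ℝ}
    {s : Set ℝ} {τ : ℝ} (hx : HasDerivWithinAt x (C.desing α k f (x τ)) s τ)
    (hτ : x τ ∈ C.domain) :
    HasDerivWithinAt (fun r => C.Tinv α (x r))
      (C.timeFactor k (x τ) • f (C.Tinv α (x τ))) s τ := by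
  rw [hasDerivWithinAt_pi]
  intro j
  have h1 := hasDerivWithinAt_kappa hC hx hτ
  have h2 := hasDerivWithinAt_shape hα hC hx j
  have hκ := kappa_pos hC hτ
  have h3 : f (C.Tinv α (x τ)) j = C.kappa (x τ) ^ (k + α j) * C.ftilde α k f (x τ) j := by
    rw [ftilde, mul_div_cancel₀ _ (pow_pos hκ _).ne']
  have h4 := timeFactor_mul_kappa_pow hC hτ
  have hαj : α j = (α j - 1) + 1 := by have := hα j; omega
  have h5 : (fun r => C.Tinv α (x r) j) = fun r => C.kappa (x r) ^ α j * C.shape (x r) j := by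
    funext r; rw [Tinv_eq]; rfl
  rw [h5, Pi.smul_apply, smul_eq_mul, h3, pow_add, ← mul_assoc, ← mul_assoc, h4]
  -- In the product rule for `κ^{α_j}` times the shape, the two `gain` terms cancel.
  refine ((h1.pow (α j)).mul h2).congr_deriv ?_
  have h6 : C.kappa (x τ) ^ α j = C.kappa (x τ) ^ (α j - 1) * C.kappa (x τ) := by
    rw [← pow_succ, ← hαj]
  simp only [Pi.pow_apply, h6]
  ring

/-- The domain is forward invariant. -/
theorem mem_domain_of_hasDerivWithinAt (hα : ∀ i, 1 ≤ α i) (hf : IsAsympQuasiHomogeneous α k f)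
    (hC : C.Admissible α k) {x v : ℝ → Fin n → ℝ}
    (hx : ∀ τ, 0 ≤ τ → HasDerivWithinAt x (v τ) (Ici 0) τ)
    (hv : ∀ τ, 0 ≤ τ → x τ ∈ C.domain → v τ = C.desing α k f (x τ))
    (h0 : x 0 ∈ C.domain) : ∀ τ, 0 ≤ τ → x τ ∈ C.domain := by
  have hxc : ContinuousOn x (Ici 0) := fun τ hτ => (hx τ hτ).continuousWithinAt
  have := pos_of_hasDerivWithinAt_neg_mul (u := fun τ => C.barrier (x τ))
    (H := fun τ => C.gainCoeff * C.gain α k f (x τ))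
    (continuous_barrier.comp_continuousOn hxc) ((mem_domain_iff hC).1 h0)
    (fun τ hτ hu => by
      have hd := (mem_domain_iff hC).2 hu
      exact hasDerivWithinAt_barrier hC (hv τ hτ hd ▸ hx τ hτ) hd) ?_
  · exact fun τ hτ => (mem_domain_iff hC).2 (this τ hτ)
  · intro τ₀ hτ₀ hu hpos
    obtain ⟨K, hK⟩ := eventually_gain_bounded hα hf hC ((mem_horizon_iff hC).2 hu)
    refine ⟨|C.gainCoeff| * K, ?_⟩
    have ht : Tendsto x (𝓝[<] τ₀) (𝓝[C.domain] (x τ₀)) := by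
      refine tendsto_nhdsWithin_iff.2 ⟨?_, ?_⟩
      · exact (hxc.continuousAt (Ici_mem_nhds hτ₀)).tendsto.mono_left nhdsWithin_le_nhds
      · filter_upwards [Ioo_mem_nhdsLT hτ₀] with τ hτ
        exact (mem_domain_iff hC).2 (hpos τ ⟨hτ.1.le, hτ.2⟩)
    filter_upwards [ht.eventually hK] with τ hτ
    rw [abs_mul]
    gcongr

/-! ### The compactification and its inverse -/

theorem one_sub_sum_div_pow {β : Fin n → ℕ} {c : ℕ} (hαβ : ∀ j, α j * β j = c) {K : ℝ} (hK : 0 < K)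
    (y : Fin n → ℝ) : 1 - ∑ i, (y i / K ^ α i) ^ (2 * β i) =
      (K ^ (2 * c) - ∑ i, y i ^ (2 * β i)) / K ^ (2 * c) := by
  have : (fun i => y i / K ^ α i) = dil α K⁻¹ y := by
    ext i; simp [dil, div_eq_inv_mul]
  have h := sum_dil_pow hαβ K⁻¹ y
  rw [← this] at h
  rw [h, sub_div, div_self (pow_pos hK _).ne', inv_pow, div_eq_inv_mul]

theorem dil_div_pow {K : ℝ} (hK : 0 < K) (y : Fin n → ℝ) :
    dil α K (fun i => y i / K ^ α i) = y := by
  ext i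
  rw [dil, mul_div_cancel₀ _ (pow_pos hK _).ne']

theorem div_pow_dil {K : ℝ} (hK : 0 < K) (x : Fin n → ℝ) :
    (fun i => dil α K x i / K ^ α i) = x := by
  ext i
  rw [dil, mul_div_cancel_left₀ _ (pow_pos hK _).ne']

/-- In the global cases `T` divides by powers of a factor `K`, and the barrier at `T y` depends on
`K` alone (`K^{-2c}` or `K^{-1}`), so `kappa` recovers `K`. -/
theorem barrier_T_and_Tinv_T (hα : ∀ i, 1 ≤ α i) (hC : C.Admissible α k) {y : Fin n → ℝ}
    (hy : y ∈ C.source) : 0 < C.barrier (C.T α y) ∧ C.Tinv α (C.T α y) = y := by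
  cases C with
  | directional i σ =>
    have hy' : 0 < ((σ : ℤ) : ℝ) * y i := hy
    have hs : 0 < (((σ : ℤ) : ℝ) * y i) ^ (-(1 : ℝ) / (α i)) := Real.rpow_pos_of_pos hy' _
    have hTi : (directional i σ).T α y i = (((σ : ℤ) : ℝ) * y i) ^ (-(1 : ℝ) / (α i)) := by
      simp [T]
    refine ⟨by simpa [barrier, hTi] using hs, ?_⟩
    ext j
    simp only [Tinv, dil, kappa, hTi]
    by_cases hj : j = i
    · subst hj
      rw [Function.update_self, inv_pow, rpow_neg_div_natCast_pow hy' (by have := hα j; omega),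
        inv_inv, mul_right_comm, sign_mul_self, one_mul]
    · rw [Function.update_of_ne hj]
      simp only [T, if_neg hj]
      rw [inv_pow, inv_mul_cancel_left₀ (pow_pos hs _).ne']
  | poincare β c =>
    have hq : 0 < 1 + ∑ i, y i ^ (2 * β i) :=
      add_pos_of_pos_of_nonneg one_pos
        (Finset.sum_nonneg fun i _ => by rw [pow_mul]; positivity)
    have hc : (2 * c : ℝ) ≠ 0 := by have := hC.1; positivity
    set K : ℝ := (1 + ∑ i, y i ^ (2 * β i)) ^ ((1 : ℝ) / (2 * c)) with hKdef
    have hK : 0 < K := Real.rpow_pos_of_pos hq _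
    have hKp : K ^ (2 * c) = 1 + ∑ i, y i ^ (2 * β i) := by
      rw [hKdef, ← Real.rpow_natCast, ← Real.rpow_mul hq.le]
      push_cast
      rw [one_div_mul_cancel hc, Real.rpow_one]
    have hT : (poincare β c).T α y = fun j => y j / K ^ α j := by
      ext j; simp only [T, pnorm_pow hC.1, ← hKdef]
    have hb : (poincare β c).barrier ((poincare β c).T α y) = (K ^ (2 * c))⁻¹ := by
      rw [hT]
      simp only [barrier]
      rw [one_sub_sum_div_pow hC.2.1 hK, ← one_div]
      congr 1
      linarith
    refine ⟨by rw [hb]; positivity, ?_⟩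
    rw [Tinv_eq, kappa_eq hC, hb]
    have hκ : kappaOf (poincare β c) (K ^ (2 * c))⁻¹ = K := by
      simp only [kappaOf]
      have := inv_pow_rpow_neg_div hK (N := 2 * c) (by have := hC.1; omega)
      push_cast at this
      rw [← inv_pow]; exact this
    rw [hκ, hT]
    exact dil_div_pow hK y
  | parabolic β c =>
    obtain ⟨h1, h2⟩ := kappaRoot_spec hC.1 (pnorm β c y)
    set K := kappaRoot c (pnorm β c y) with hKdef
    have hK : 0 < K := one_pos.trans_le h1
    rw [pnorm_pow hC.1] at h2
    have hT : (parabolic β c).T α y = fun j => y j / K ^ α j := rfl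
    have hb : (parabolic β c).barrier ((parabolic β c).T α y) = K⁻¹ := by
      rw [hT]
      simp only [barrier]
      rw [one_sub_sum_div_pow hC.2 hK, ← h2, sub_sub_cancel]
      have : K ^ (2 * c) = K ^ (2 * c - 1) * K := by
        rw [← pow_succ]; congr 1; have := hC.1; omega
      rw [this]
      field_simp
    refine ⟨by rw [hb]; positivity, ?_⟩
    rw [Tinv_eq, kappa_eq hC, hb]
    have hκ : kappaOf (parabolic β c) K⁻¹ = K := inv_inv K
    rw [hκ, hT]
    exact dil_div_pow hK y

theorem T_mem_domain (hα : ∀ i, 1 ≤ α i) (hC : C.Admissible α k) {y : Fin n → ℝ}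
    (hy : y ∈ C.source) : C.T α y ∈ C.domain :=
  (mem_domain_iff hC).2 (barrier_T_and_Tinv_T hα hC hy).1

theorem Tinv_T (hα : ∀ i, 1 ≤ α i) (hC : C.Admissible α k) {y : Fin n → ℝ}
    (hy : y ∈ C.source) : C.Tinv α (C.T α y) = y :=
  (barrier_T_and_Tinv_T hα hC hy).2

/-- In the global cases, with barrier value `u`, dilation turns `p^{2c} = 1 - u` into `κ^{2c}(1 -
u)`. This is `κ^{2c} - 1` when `κ^{2c} = 1/u`, and `κ^{2c} - κ^{2c-1}` when `κ = 1/u`, so `T`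
divides by the same `κ`. -/
theorem Tinv_mem_source_and_T_Tinv (hα : ∀ i, 1 ≤ α i) (hC : C.Admissible α k) {x : Fin n → ℝ}
    (hx : x ∈ C.domain) : C.Tinv α x ∈ C.source ∧ C.T α (C.Tinv α x) = x := by
  have hκ := kappa_pos hC hx
  rw [mem_domain_iff hC] at hx
  cases C with
  | directional i σ =>
    have hx' : 0 < x i := hx
    have hi : ((σ : ℤ) : ℝ) * (directional i σ).Tinv α x i = (x i)⁻¹ ^ α i := by
      simp only [Tinv, dil, kappa, Function.update_self]
      rw [mul_left_comm, sign_mul_self, mul_one]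
    have hs : (((σ : ℤ) : ℝ) * (directional i σ).Tinv α x i) ^ (-(1 : ℝ) / (α i)) = x i := by
      rw [hi, inv_pow_rpow_neg_div hx' (by have := hα i; omega)]
    refine ⟨?_, ?_⟩
    · change 0 < ((σ : ℤ) : ℝ) * (directional i σ).Tinv α x i
      rw [hi]; positivity
    · ext j
      simp only [T, hs]
      split_ifs with hj
      · rw [hj]
      · simp only [Tinv, dil, kappa, Function.update_of_ne hj, inv_pow]
        rw [mul_inv_cancel_left₀ (pow_pos hx' _).ne']
  | poincare β c =>
    refine ⟨mem_univ _, ?_⟩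
    have hTinv : (poincare β c).Tinv α x = dil α ((poincare β c).kappa x) x := rfl
    have hK : (1 + pnorm β c ((poincare β c).Tinv α x) ^ (2 * c)) ^ ((1 : ℝ) / (2 * c)) =
        (poincare β c).kappa x := by
      have hc : 2 * c ≠ 0 := by have := hC.1; omega
      have h1 : (poincare β c).kappa x ^ (2 * c) = ((poincare β c).barrier x)⁻¹ := by
        rw [kappa_eq hC]
        have := rpow_neg_div_natCast_pow hx hc
        push_cast at this
        exact this
      have h2 : 1 + pnorm β c ((poincare β c).Tinv α x) ^ (2 * c) =
          (poincare β c).kappa x ^ (2 * c) := by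
        have h3 : ∑ i, x i ^ (2 * β i) = 1 - (poincare β c).barrier x := by
          simp [barrier]
        rw [hTinv, pnorm_pow hC.1, sum_dil_pow hC.2.1, h1, h3]
        have := hx.ne'
        field_simp
        ring
      rw [h2]
      have := Real.pow_rpow_inv_natCast hκ.le hc
      push_cast at this
      rw [one_div]; exact this
    ext j
    simp only [T, hK]
    exact congrFun (div_pow_dil hκ x) j
  | parabolic β c =>
    refine ⟨mem_univ _, ?_⟩
    have hTinv : (parabolic β c).Tinv α x = dil α ((parabolic β c).kappa x) x := rfl
    have hκu : (parabolic β c).kappa x = ((parabolic β c).barrier x)⁻¹ := kappa_eq hC x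
    have h3 : ∑ i, x i ^ (2 * β i) = 1 - (parabolic β c).barrier x := by simp [barrier]
    have h3' : 0 ≤ ∑ i, x i ^ (2 * β i) :=
      Finset.sum_nonneg fun i _ => by rw [pow_mul]; positivity
    have hK : kappaRoot c (pnorm β c ((parabolic β c).Tinv α x)) = (parabolic β c).kappa x := by
      refine kappaRoot_unique hC.1 ?_ ?_
      · rw [hκu]
        exact (one_le_inv₀ hx).2 (by linarith)
      · rw [hTinv, pnorm_pow hC.1, sum_dil_pow hC.2, h3, mul_sub, mul_one, hκu]
        congr 1
        obtain ⟨d, hd⟩ : ∃ d, 2 * c = d + 1 := ⟨2 * c - 1, by have := hC.1; omega⟩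
        rw [hd, Nat.add_sub_cancel, pow_succ, mul_assoc, inv_mul_cancel₀ hx.ne', mul_one]
    ext j
    simp only [T, hK]
    exact congrFun (div_pow_dil hκ x) j

theorem Tinv_mem_source (hα : ∀ i, 1 ≤ α i) (hC : C.Admissible α k) {x : Fin n → ℝ}
    (hx : x ∈ C.domain) : C.Tinv α x ∈ C.source :=
  (Tinv_mem_source_and_T_Tinv hα hC hx).1

theorem T_Tinv (hα : ∀ i, 1 ≤ α i) (hC : C.Admissible α k) {x : Fin n → ℝ}
    (hx : x ∈ C.domain) : C.T α (C.Tinv α x) = x :=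
  (Tinv_mem_source_and_T_Tinv hα hC hx).2

end Compactification

/-! ### Analyticity of the compactifications -/

theorem analyticAt_apply_pi {n : ℕ} (i : Fin n) (y : Fin n → ℝ) :
    AnalyticAt ℝ (fun y : Fin n → ℝ => y i) y :=
  (ContinuousLinearMap.proj (R := ℝ) (φ := fun _ : Fin n => ℝ) i).analyticAt y

theorem analyticAt_rpow_const_of_pos {E : Type*} [NormedAddCommGroup E] [NormedSpace ℝ E]
    {h : E → ℝ} {x : E} (hh : AnalyticAt ℝ h x) (hx : 0 < h x) (r : ℝ) :
    AnalyticAt ℝ (fun y => h y ^ r) x := by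
  have h1 : AnalyticAt ℝ (fun y => Real.exp (Real.log (h y) * r)) x :=
    analyticAt_rexp.fun_comp (((analyticAt_log hx).fun_comp hh).fun_mul analyticAt_const)
  refine h1.congr ?_
  filter_upwards [hh.continuousAt.eventually (lt_mem_nhds hx)] with y hy
  rw [Real.rpow_def_of_pos hy]

/-- `kappaRoot` is locally an analytic function of `R^{2c}`. -/
theorem exists_analyticAt_kappaRoot {c : ℕ} (hc : 1 ≤ c) (R₀ : ℝ) :
    ∃ ψ : ℝ → ℝ, AnalyticAt ℝ ψ (R₀ ^ (2 * c)) ∧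
      ∀ᶠ q in 𝓝 (R₀ ^ (2 * c)), ∀ R : ℝ, R ^ (2 * c) = q → kappaRoot c R = ψ q := by
  obtain ⟨d, hd⟩ : ∃ d, 2 * c = d + 1 := ⟨2 * c - 1, by omega⟩
  have hd' : 2 * c - 1 = d := by omega
  obtain ⟨h1, h2⟩ := kappaRoot_spec hc R₀
  set κ₀ := kappaRoot c R₀ with hκ₀
  have hκpos : 0 < κ₀ := one_pos.trans_le h1
  set h : ℝ → ℝ := fun κ => κ ^ (2 * c) - κ ^ (2 * c - 1) with hh
  have ha : AnalyticAt ℝ h κ₀ := (analyticAt_id.pow _).sub (analyticAt_id.pow _)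
  -- With `2c = e + 2` the derivative is `κ^e (κ + (e+1)(κ-1))`, which is positive for `κ ≥ 1`.
  have hder : deriv h κ₀ ≠ 0 := by
    have h3 : HasDerivAt h (((d + 1 : ℕ) : ℝ) * κ₀ ^ d - (d : ℝ) * κ₀ ^ (d - 1)) κ₀ := by
      have := (hasDerivAt_pow (d + 1) κ₀).sub (hasDerivAt_pow d κ₀)
      rw [Nat.add_sub_cancel] at this
      have e : h = (fun κ : ℝ => κ ^ (d + 1)) - fun κ => κ ^ d := by
        funext κ; simp only [hh, hd, Nat.add_sub_cancel, Pi.sub_apply]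
      rw [e]; exact this
    rw [h3.deriv]
    obtain ⟨e, rfl⟩ : ∃ e, d = e + 1 := ⟨d - 1, by omega⟩
    have h4 : 0 < κ₀ ^ e := pow_pos hκpos e
    have : ((e + 1 + 1 : ℕ) : ℝ) * κ₀ ^ (e + 1) - ((e + 1 : ℕ) : ℝ) * κ₀ ^ (e + 1 - 1) =
        κ₀ ^ e * (κ₀ + (e + 1) * (κ₀ - 1)) := by
      rw [Nat.add_sub_cancel]; push_cast; ring
    rw [this]
    refine (mul_pos h4 (add_pos_of_pos_of_nonneg hκpos
      (mul_nonneg (by positivity) (sub_nonneg.2 h1)))).ne'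
  set ψ := ha.hasStrictDerivAt.localInverse _ _ _ hder with hψ
  have hψa : AnalyticAt ℝ ψ (h κ₀) := ha.analyticAt_localInverse hder
  have hq0 : h κ₀ = R₀ ^ (2 * c) := h2
  have hψ0 : ψ (h κ₀) = κ₀ := HasStrictFDerivAt.localInverse_apply_image ..
  have hright : ∀ᶠ q in 𝓝 (h κ₀), h (ψ q) = q :=
    HasStrictFDerivAt.eventually_right_inverse ..
  have hpos : ∀ᶠ q in 𝓝 (h κ₀), 0 < ψ q :=
    hψa.continuousAt.eventually (lt_mem_nhds (by rwa [hψ0]))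
  rw [hq0] at hψa hright hpos
  refine ⟨ψ, hψa, ?_⟩
  filter_upwards [hright, hpos] with q hq1 hq2 R hR
  refine kappaRoot_unique hc ?_ (hq1.trans hR.symm)
  -- For `ψ q > 0`, nonnegativity of `ψ^{2c-1}(ψ - 1)` forces `ψ q ≥ 1`, so the local inverse
  -- selects the right root.
  have h5 : 0 ≤ ψ q ^ (2 * c) - ψ q ^ (2 * c - 1) := by
    have : 0 ≤ R ^ (2 * c) := by rw [pow_mul]; positivity
    exact this.trans_eq (hR.trans hq1.symm)
  rw [hd', hd, pow_succ] at h5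
  have h6 : 0 < ψ q ^ d := pow_pos hq2 d
  by_contra! h7
  nlinarith

/-- `pnorm` need not be analytic at the origin, but the scaling factors depend only on the
polynomial `p^{2c}`. -/
theorem Compactification.analyticAt_T {n : ℕ} {α : Fin n → ℕ} {k : ℕ} {C : Compactification n}
    (hC : C.Admissible α k) {y : Fin n → ℝ} (hy : y ∈ C.source) : AnalyticAt ℝ (C.T α) y := by
  have hsum : ∀ β : Fin n → ℕ, AnalyticAt ℝ (fun y : Fin n → ℝ => ∑ i, y i ^ (2 * β i)) y :=
    fun β => Finset.analyticAt_fun_sum _ fun i _ => (analyticAt_apply_pi i y).pow _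
  refine analyticAt_pi_iff.2 fun j => ?_
  have hdiv : ∀ K : (Fin n → ℝ) → ℝ, AnalyticAt ℝ K y → 0 < K y →
      AnalyticAt ℝ (fun y => y j / K y ^ α j) y := fun K hK hK0 =>
    (analyticAt_apply_pi j y).div (hK.pow _) (pow_pos hK0 _).ne'
  cases C with
  | directional i σ =>
    have hs : AnalyticAt ℝ (fun y : Fin n → ℝ => (((σ : ℤ) : ℝ) * y i) ^ (-(1 : ℝ) / (α i))) y :=
      analyticAt_rpow_const_of_pos (analyticAt_const.mul (analyticAt_apply_pi i y)) hy _
    simp only [T]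
    split_ifs
    · exact hs
    · exact (hs.pow _).mul (analyticAt_apply_pi j y)
  | poincare β c =>
    simp only [T, pnorm_pow hC.1]
    have hq : 0 < 1 + ∑ i, y i ^ (2 * β i) :=
      add_pos_of_pos_of_nonneg one_pos
        (Finset.sum_nonneg fun i _ => by rw [pow_mul]; positivity)
    exact hdiv _ (analyticAt_rpow_const_of_pos (analyticAt_const.add (hsum β)) hq _)
      (Real.rpow_pos_of_pos hq _)
  | parabolic β c =>
    refine hdiv (fun y => kappaRoot c (pnorm β c y)) ?_ (kappaRoot_pos hC.1 _)
    obtain ⟨ψ, hψ, hev⟩ := exists_analyticAt_kappaRoot hC.1 (pnorm β c y)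
    rw [pnorm_pow hC.1] at hψ hev
    have h1 : AnalyticAt ℝ (fun y : Fin n → ℝ => ψ (∑ i, y i ^ (2 * β i))) y :=
      AnalyticAt.fun_comp hψ (hsum β)
    refine h1.congr ?_
    filter_upwards [(hsum β).continuousAt.eventually hev] with z hz
    exact (hz (pnorm β c z) (pnorm_pow hC.1 z)).symm

/-! ### Analytic left inverses -/

/-- For a linear left inverse `L` of the derivative, `L ∘ P` is a local analytic diffeomorphism of
the parameter space; take `R = (L ∘ P)⁻¹ ∘ L`. -/
theorem exists_analytic_leftInverse {n m : ℕ} {P : (Fin m → ℝ) → (Fin n → ℝ)} {θ₀ : Fin m → ℝ}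
    (hP : AnalyticAt ℝ P θ₀) (hinj : Function.Injective (fderiv ℝ P θ₀)) :
    ∃ R : (Fin n → ℝ) → (Fin m → ℝ), AnalyticAt ℝ R (P θ₀) ∧ ∀ᶠ θ in 𝓝 θ₀, R (P θ) = θ := by
  obtain ⟨L, hL⟩ := (fderiv ℝ P θ₀ : (Fin m → ℝ) →ₗ[ℝ] (Fin n → ℝ)).exists_leftInverse_of_injective
    (LinearMap.ker_eq_bot.2 hinj)
  set L' : (Fin n → ℝ) →L[ℝ] (Fin m → ℝ) := LinearMap.toContinuousLinearMap L with hL'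
  have hcomp : L'.comp (fderiv ℝ P θ₀) = (ContinuousLinearEquiv.refl ℝ (Fin m → ℝ) :
      (Fin m → ℝ) →L[ℝ] (Fin m → ℝ)) := by
    ext1 v
    exact LinearMap.congr_fun hL v
  have ha : AnalyticAt ℝ (fun θ => L' (P θ)) θ₀ := (L'.analyticAt _).comp hP
  have hd : HasStrictFDerivAt (fun θ => L' (P θ)) (ContinuousLinearEquiv.refl ℝ (Fin m → ℝ) :
      (Fin m → ℝ) →L[ℝ] (Fin m → ℝ)) θ₀ := by
    rw [← hcomp]
    exact L'.hasStrictFDerivAt.comp θ₀ hP.hasStrictFDerivAt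
  set Φ := hd.toOpenPartialHomeomorph _ with hΦ
  have hmem : θ₀ ∈ Φ.source := hd.mem_toOpenPartialHomeomorph_source
  have hsymm : AnalyticAt ℝ Φ.symm (Φ θ₀) :=
    Φ.analyticAt_symm' hmem ha hd.hasFDerivAt.fderiv
  refine ⟨fun x => Φ.symm (L' x), AnalyticAt.fun_comp (f := L') hsymm (L'.analyticAt _), ?_⟩
  filter_upwards [Φ.open_source.mem_nhds hmem] with θ hθ
  exact Φ.left_inv hθ

/-! ### The parameterized stable manifold -/

theorem contDiff_polyField {n : ℕ} (g : Fin n → MvPolynomial (Fin n) ℝ) :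
    ContDiff ℝ 1 (polyField g) := by
  rw [contDiff_pi]
  intro i
  refine AnalyticOnNhd.contDiff (fun x _ => ?_)
  have := AnalyticAt.aeval_mvPolynomial (𝕜 := ℝ) (B := ℝ) (f := fun x : Fin n → ℝ => x) (z := x)
    (fun j => analyticAt_apply_pi j x) (g i)
  simpa [polyField, MvPolynomial.aeval_def] using this

namespace IsStableParameterization

variable {n m : ℕ} {g : Fin n → MvPolynomial (Fin n) ℝ} {p : Fin n → ℝ} {lam : Fin m → ℝ}
  {ξ : Fin m → Fin n → ℝ} {a : (Fin m → ℕ) → (Fin n → ℝ)}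

theorem lam_neg (hP : IsStableParameterization g p lam ξ a) (i : Fin m) : lam i < 0 :=
  ((hP.lam_stable (lam i)).2 ⟨i, rfl⟩).1

theorem continuousOn (hP : IsStableParameterization g p lam ξ a) :
    ContinuousOn (powerSeries a) (polydisc m) :=
  continuousOn_tsum_monomial hP.summable

theorem analyticAt (hP : IsStableParameterization g p lam ξ a) {θ : Fin m → ℝ}
    (hθ : θ ∈ openPolydisc m) : AnalyticAt ℝ (powerSeries a) θ :=
  analyticAt_tsum_monomial hP.summable hθ

theorem powerSeries_zero (hP : IsStableParameterization g p lam ξ a) : powerSeries a 0 = p := by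
  rw [powerSeries, tsum_eq_single 0]
  · simp [hP.coeff_zero]
  · intro γ hγ
    obtain ⟨j, hj⟩ := Function.ne_iff.1 hγ
    rw [Finset.prod_eq_zero (Finset.mem_univ j) (by simpa using hj), zero_smul]

theorem isSolutionOn (hP : IsStableParameterization g p lam ξ a) {θ : Fin m → ℝ}
    (hθ : θ ∈ polydisc m) (T : ℝ) :
    IsSolutionOn (polyField g) (fun τ => powerSeries a (linFlow lam τ θ)) T :=
  fun τ hτ => (hP.conjugacy θ hθ τ hτ.1).mono Ico_subset_Ici_self

/-- The image of the polydisc is compact and the trajectories stay in it, so one Lipschitz constant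
of the field serves all of them. -/
theorem exists_gronwall (hP : IsStableParameterization g p lam ξ a) :
    ∃ K : ℝ, ∀ θ ∈ polydisc m, ∀ θ' ∈ polydisc m, ∀ τ : ℝ, 0 ≤ τ →
      ‖powerSeries a (linFlow lam τ θ) - powerSeries a (linFlow lam τ θ')‖ ≤
        ‖powerSeries a θ - powerSeries a θ'‖ * Real.exp (K * τ) := by
  obtain ⟨R, hR⟩ := ((isCompact_polydisc m).image_of_continuousOn
    hP.continuousOn).isBounded.subset_closedBall 0
  obtain ⟨K, hK⟩ := exists_lipschitzOnWith_closedBall (contDiff_polyField g) R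
  refine ⟨K, fun θ hθ θ' hθ' τ hτ => ?_⟩
  have hmem : ∀ θ ∈ polydisc m, ∀ t, 0 ≤ t →
      powerSeries a (linFlow lam t θ) ∈ Metric.closedBall (0 : Fin n → ℝ) R :=
    fun θ hθ t ht => hR (mem_image_of_mem _ (linFlow_mem_polydisc hP.lam_neg hθ ht))
  have hcont : ∀ θ ∈ polydisc m,
      ContinuousOn (fun r => powerSeries a (linFlow lam r θ)) (Icc 0 τ) := fun θ hθ t ht =>
    (hP.conjugacy θ hθ t ht.1).continuousWithinAt.mono Icc_subset_Ici_self
  have hder : ∀ θ ∈ polydisc m, ∀ t ∈ Ico 0 τ,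
      HasDerivWithinAt (fun r => powerSeries a (linFlow lam r θ))
        (polyField g (powerSeries a (linFlow lam t θ))) (Ici t) t := fun θ hθ t ht =>
    (hP.conjugacy θ hθ t ht.1).mono (Ici_subset_Ici.2 ht.1)
  have := dist_le_of_trajectories_ODE_of_mem (v := fun _ => polyField g) (fun _ _ => hK)
    (hcont θ hθ) (hder θ hθ) (fun t ht => hmem θ hθ t ht.1) (hcont θ' hθ') (hder θ' hθ')
    (fun t ht => hmem θ' hθ' t ht.1) le_rfl τ ⟨hτ, le_rfl⟩
  simpa [linFlow_zero, dist_eq_norm] using this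

theorem fderiv_zero_injective (hP : IsStableParameterization g p lam ξ a) :
    Function.Injective (fderiv ℝ (powerSeries a) 0) := by
  obtain ⟨L, hL, hd⟩ := hasStrictFDerivAt_tsum_monomial_zero hP.summable
  have hfd : fderiv ℝ (powerSeries a) 0 = L := hd.hasFDerivAt.fderiv
  rw [hfd]
  have hli : LinearIndependent ℝ ξ :=
    Module.End.eigenvectors_linearIndependent' (jacobian g p) lam hP.lam_injective ξ hP.eigenvector
  rw [injective_iff_map_eq_zero]
  intro v hv
  rw [hL] at hv
  simp only [hP.coeff_single] at hv
  funext j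
  exact Fintype.linearIndependent_iff.1 hli v hv j

/-- Equal points have equal trajectories. Their parameters eventually enter the region near `0`
where `P` has a left inverse, and the linear flow is injective. -/
theorem injOn (hP : IsStableParameterization g p lam ξ a) :
    InjOn (powerSeries a) (polydisc m) := by
  intro θ hθ θ' hθ' h
  obtain ⟨K, hK⟩ := hP.exists_gronwall
  obtain ⟨R, -, hR⟩ := exists_analytic_leftInverse (hP.analyticAt (zero_mem_openPolydisc m))
    hP.fderiv_zero_injective
  obtain ⟨τ, h1, h2, hτ⟩ := (((tendsto_linFlow hP.lam_neg θ).eventually hR).and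
    (((tendsto_linFlow hP.lam_neg θ').eventually hR).and (eventually_ge_atTop 0))).exists
  have h3 := hK θ hθ θ' hθ' τ hτ
  rw [h, sub_self, norm_zero, zero_mul, norm_le_zero_iff, sub_eq_zero] at h3
  have h4 : linFlow lam τ θ = linFlow lam τ θ' := by rw [← h1, h3, h2]
  funext i
  exact mul_left_cancel₀ (Real.exp_pos _).ne' (congrFun h4 i)

/-- If `v` is in the kernel at `θ`, then by Gronwall `e^{Λτ}v` is in the kernel at `e^{Λτ}θ`. For
large `τ` that point is close to `0`, where injectivity persists as an open condition. -/
theorem fderiv_injective (hP : IsStableParameterization g p lam ξ a) {θ : Fin m → ℝ}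
    (hθ : θ ∈ openPolydisc m) : Function.Injective (fderiv ℝ (powerSeries a) θ) := by
  obtain ⟨K, hK⟩ := hP.exists_gronwall
  have hopen : ∀ᶠ θ' in 𝓝 (0 : Fin m → ℝ), Function.Injective (fderiv ℝ (powerSeries a) θ') := by
    have := (hP.analyticAt (zero_mem_openPolydisc m)).fderiv.continuousAt
    exact this.eventually (ContinuousLinearMap.isOpen_injective.mem_nhds hP.fderiv_zero_injective)
  obtain ⟨τ, hinj, hτ⟩ := (((tendsto_linFlow hP.lam_neg θ).eventually hopen).and
    (eventually_ge_atTop 0)).exists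
  rw [injective_iff_map_eq_zero]
  intro v hv
  have hline : HasDerivAt (fun h : ℝ => θ + h • v) v 0 := by
    simpa using ((hasDerivAt_id (0 : ℝ)).smul_const v).const_add θ
  have hmem : ∀ᶠ h in 𝓝 (0 : ℝ), θ + h • v ∈ openPolydisc m := by
    have : ContinuousAt (fun h : ℝ => θ + h • v) 0 := hline.continuousAt
    refine this.eventually ((isOpen_openPolydisc m).mem_nhds ?_)
    simpa using hθ
  have h1 : HasDerivAt (fun h : ℝ => powerSeries a (θ + h • v)) 0 0 := by
    rw [← hv]
    refine HasFDerivAt.comp_hasDerivAt (l := powerSeries a) 0 ?_ hline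
    simpa using (hP.analyticAt hθ).differentiableAt.hasFDerivAt
  have hflow : HasDerivAt (fun h : ℝ => linFlow lam τ (θ + h • v)) (linFlow lam τ v) 0 := by
    rw [hasDerivAt_pi]
    intro i
    exact ((hasDerivAt_pi.1 hline) i).const_mul _
  have hθτ : linFlow lam τ θ ∈ openPolydisc m := by
    rcases hτ.eq_or_lt with h | h
    · rwa [← h, linFlow_zero]
    · exact linFlow_mem_openPolydisc hP.lam_neg (openPolydisc_subset m hθ) h
  have h2 : HasDerivAt (fun h : ℝ => powerSeries a (linFlow lam τ (θ + h • v)))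
      (fderiv ℝ (powerSeries a) (linFlow lam τ θ) (linFlow lam τ v)) 0 := by
    refine HasFDerivAt.comp_hasDerivAt (l := powerSeries a) 0 ?_ hflow
    simpa using (hP.analyticAt hθτ).differentiableAt.hasFDerivAt
  have h3 : HasDerivAt (fun h : ℝ => powerSeries a (linFlow lam τ (θ + h • v))) 0 0 := by
    rw [hasDerivAt_iff_isLittleO_nhds_zero] at h1 ⊢
    simp only [smul_zero, sub_zero, zero_add, zero_smul, add_zero] at h1 ⊢
    refine Asymptotics.IsBigO.trans_isLittleO (Asymptotics.IsBigO.of_bound (Real.exp (K * τ)) ?_) h1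
    filter_upwards [hmem] with h hh
    rw [mul_comm]
    exact hK _ (openPolydisc_subset m hh) _ (openPolydisc_subset m hθ) τ hτ
  have h4 : linFlow lam τ v = 0 :=
    (injective_iff_map_eq_zero _).1 hinj _ (h2.unique h3)
  funext i
  exact (mul_eq_zero.1 (congrFun h4 i)).resolve_left (Real.exp_pos _).ne'

/-- Parameters of nearby points of the manifold are close. -/
theorem eventually_mem_of_powerSeries_eq (hP : IsStableParameterization g p lam ξ a)
    {θ₀ : Fin m → ℝ} (hθ₀ : θ₀ ∈ polydisc m) {N : Set (Fin m → ℝ)} (hN : N ∈ 𝓝 θ₀) :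
    ∀ᶠ x in 𝓝 (powerSeries a θ₀), ∀ θ ∈ polydisc m, powerSeries a θ = x → θ ∈ N := by
  -- The parameters away from `θ₀` form a compact set; by injectivity its closed image misses
  -- `P(θ₀)`.
  have hcl : IsClosed (powerSeries a '' (polydisc m \ interior N)) :=
    (((isCompact_polydisc m).diff isOpen_interior).image_of_continuousOn
      (hP.continuousOn.mono sdiff_subset)).isClosed
  have hnot : powerSeries a θ₀ ∉ powerSeries a '' (polydisc m \ interior N) := by
    rintro ⟨θ, hθ, h⟩
    have := hP.injOn hθ.1 hθ₀ h
    exact hθ.2 (this ▸ mem_interior_iff_mem_nhds.2 hN)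
  filter_upwards [hcl.isOpen_compl.mem_nhds hnot] with x hx θ hθ h
  by_contra hcon
  exact hx ⟨θ, ⟨hθ, fun h' => hcon (interior_subset h')⟩, h⟩

/-- Interior points of the manifold have parameters in the open polydisc. -/
theorem mem_openPolydisc_of_image_mem_nhds (hP : IsStableParameterization g p lam ξ a)
    {θ₀ : Fin m → ℝ} (hθ₀ : θ₀ ∈ polydisc m)
    (hW : powerSeries a '' polydisc m ∈ 𝓝 (powerSeries a θ₀)) : θ₀ ∈ openPolydisc m := by
  obtain ⟨r, hr, ε, hε, hsol⟩ :=
    (contDiff_polyField g).contDiffAt.exists_forall_mem_closedBall_exists_eq_forall_mem_Ioo_hasDerivAt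
      (x₀ := powerSeries a θ₀) 0
  obtain ⟨z, hz0, hz⟩ := hsol _ (Metric.mem_closedBall_self hr.le)
  have hzc : ContinuousAt z 0 := (hz 0 (by simp [hε])).continuousAt
  have hev : ∀ᶠ t in 𝓝 (0 : ℝ), z t ∈ powerSeries a '' polydisc m :=
    hzc.eventually (by rwa [hz0])
  obtain ⟨δ, hδ, hδW⟩ := Metric.eventually_nhds_iff.1 hev
  set η := min δ ε / 2 with hη
  have hη0 : 0 < η := half_pos (lt_min hδ hε)
  have hηδ : η < δ := (half_lt_self (lt_min hδ hε)).trans_le (min_le_left _ _)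
  have hηε : η < ε := (half_lt_self (lt_min hδ hε)).trans_le (min_le_right _ _)
  -- The point reached after going back by time `η` still lies in `W`; its parameter in the closed
  -- polydisc is contracted strictly inside by flowing forwards for time `η`.
  obtain ⟨θ', hθ', hzθ⟩ := hδW (y := -η) (by simpa [abs_of_pos hη0] using hηδ)
  have hsol' : IsSolutionOn (polyField g) (fun τ => z (τ - η)) (η + ε) := by
    intro τ hτ
    have h1 : τ - η ∈ Ioo (0 - ε) (0 + ε) := ⟨by linarith [hτ.1], by linarith [hτ.2]⟩
    have := HasDerivAt.comp_sub_const τ η (hz _ h1)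
    exact this.hasDerivWithinAt
  have heq := hsol'.eqOn (contDiff_polyField g) (hP.isSolutionOn hθ' (η + 1))
    (by simp only [zero_sub, linFlow_zero, hzθ]) hη0.le (by linarith) (by linarith)
  simp only [sub_self, hz0] at heq
  rw [hP.injOn hθ₀ (linFlow_mem_polydisc hP.lam_neg hθ' hη0.le) heq]
  exact linFlow_mem_openPolydisc hP.lam_neg hθ' hη0

end IsStableParameterization

/-! ### Blow-up along the stable manifold -/

section

variable {n m : ℕ} {α : Fin n → ℕ} {k : ℕ} {f : (Fin n → ℝ) → (Fin n → ℝ)}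
  {C : Compactification n} {g : Fin n → MvPolynomial (Fin n) ℝ} {p : Fin n → ℝ} {lam : Fin m → ℝ}
  {ξ : Fin m → Fin n → ℝ} {a : (Fin m → ℕ) → (Fin n → ℝ)}

/-- The integral of the time factor along the manifold is an absolutely convergent power series. -/
theorem exists_blowUpTime_expansion (hk : 1 ≤ k) (hC : C.Admissible α k) (hp : p ∈ C.horizon)
    (hP : IsStableParameterization g p lam ξ a) :
    ∃ c : (Fin m → ℕ) → ℝ, (Summable fun γ => ‖c γ‖) ∧ ∀ θ ∈ polydisc m,
      IntegrableOn (fun τ => C.timeFactor k (powerSeries a (linFlow lam τ θ))) (Ioi 0) ∧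
      ∫ τ in Ioi (0 : ℝ), C.timeFactor k (powerSeries a (linFlow lam τ θ)) =
        ∑' γ, (∏ i, θ i ^ γ i) • c γ := by
  obtain ⟨s, hs⟩ := Compactification.exists_polynomial_timeFactor hC
  have H := hasExpansion_eval_powerSeries hP.summable s
  simp only [← hs] at H
  refine H.integral_linFlow hP.lam_neg ?_
  rw [hP.powerSeries_zero]
  exact Compactification.timeFactor_eq_zero hk hC hp

/-- The trajectory on the manifold through a point of the domain stays in the domain. -/
theorem powerSeries_linFlow_mem_domain (hα : ∀ i, 1 ≤ α i) (hf : IsAsympQuasiHomogeneous α k f)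
    (hC : C.Admissible α k) (hg : ∀ x ∈ C.domain, polyField g x = C.desing α k f x)
    (hP : IsStableParameterization g p lam ξ a) {θ : Fin m → ℝ} (hθ : θ ∈ polydisc m)
    (hdom : powerSeries a θ ∈ C.domain) {τ : ℝ} (hτ : 0 ≤ τ) :
    powerSeries a (linFlow lam τ θ) ∈ C.domain :=
  Compactification.mem_domain_of_hasDerivWithinAt hα hf hC
    (x := fun τ => powerSeries a (linFlow lam τ θ)) (hP.conjugacy θ hθ)
    (fun _ _ hx => hg _ hx) (by rwa [linFlow_zero]) τ hτ

theorem exists_blowUp_solution (hα : ∀ i, 1 ≤ α i) (hk : 1 ≤ k)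
    (hf : IsAsympQuasiHomogeneous α k f) (hC : C.Admissible α k)
    (hg : ∀ x ∈ C.domain, polyField g x = C.desing α k f x) (hp : p ∈ C.horizon)
    (hP : IsStableParameterization g p lam ξ a) {θ : Fin m → ℝ} (hθ : θ ∈ polydisc m)
    {y₀ : Fin n → ℝ} (hy₀ : y₀ ∈ C.source) (hθy : powerSeries a θ = C.T α y₀) :
    0 < ∫ τ in Ioi (0 : ℝ), C.timeFactor k (powerSeries a (linFlow lam τ θ)) ∧
    ∃ y : ℝ → Fin n → ℝ, y 0 = y₀ ∧
      IsSolutionOn f y (∫ τ in Ioi (0 : ℝ), C.timeFactor k (powerSeries a (linFlow lam τ θ))) ∧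
      (∀ t ∈ Ico 0 (∫ τ in Ioi (0 : ℝ), C.timeFactor k (powerSeries a (linFlow lam τ θ))),
        y t ∈ C.preimage α (powerSeries a '' polydisc m)) ∧
      Tendsto y (𝓝[<] (∫ τ in Ioi (0 : ℝ), C.timeFactor k (powerSeries a (linFlow lam τ θ))))
        (Bornology.cobounded (Fin n → ℝ)) := by
  obtain ⟨c, -, hc⟩ := exists_blowUpTime_expansion hk hC hp hP
  have hdom : ∀ τ, 0 ≤ τ → powerSeries a (linFlow lam τ θ) ∈ C.domain := fun τ hτ =>
    powerSeries_linFlow_mem_domain hα hf hC hg hP hθ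
      (hθy ▸ Compactification.T_mem_domain hα hC hy₀) hτ
  have hxc : ContinuousOn (fun τ => powerSeries a (linFlow lam τ θ)) (Ici 0) :=
    fun τ hτ => (hP.conjugacy θ hθ τ hτ).continuousWithinAt
  have hσc : ContinuousOn (fun τ => C.timeFactor k (powerSeries a (linFlow lam τ θ))) (Ici 0) := by
    obtain ⟨s, hs⟩ := Compactification.exists_polynomial_timeFactor hC
    simp only [hs]
    exact (MvPolynomial.continuous_eval s).comp_continuousOn hxc
  obtain ⟨hpos, s, hs0, hsnn, hslim, hsol⟩ := exists_isSolutionOn_of_timeChange (f := f)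
    (Y := fun τ => C.Tinv α (powerSeries a (linFlow lam τ θ))) hσc
    (fun τ hτ => Compactification.timeFactor_pos hC (hdom τ hτ)) (hc θ hθ).1
    (fun τ hτ => Compactification.hasDerivWithinAt_Tinv hα hC
      (x := fun τ => powerSeries a (linFlow lam τ θ))
      (hg _ (hdom τ hτ) ▸ hP.conjugacy θ hθ τ hτ) (hdom τ hτ))
  refine ⟨hpos, _, ?_, hsol, fun t ht => ?_, ?_⟩
  · simp only [hs0, linFlow_zero, hθy]
    exact Compactification.Tinv_T hα hC hy₀
  · have := hdom _ (hsnn t ht)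
    refine ⟨Compactification.Tinv_mem_source hα hC this, ?_⟩
    rw [Compactification.T_Tinv hα hC this]
    exact mem_image_of_mem _ (linFlow_mem_polydisc hP.lam_neg hθ (hsnn t ht))
  · have hlim : Tendsto (fun τ => powerSeries a (linFlow lam τ θ)) atTop (𝓝[C.domain] p) := by
      refine tendsto_nhdsWithin_iff.2 ⟨?_, ?_⟩
      · have := (hP.analyticAt (zero_mem_openPolydisc m)).continuousAt.tendsto.comp
          (tendsto_linFlow hP.lam_neg θ)
        rwa [hP.powerSeries_zero] at this
      · filter_upwards [eventually_ge_atTop 0] with τ hτ using hdom τ hτ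
    exact ((Compactification.tendsto_Tinv_cobounded hα hC hp).comp hlim).comp hslim

theorem tmax_eq_integral (hα : ∀ i, 1 ≤ α i) (hk : 1 ≤ k)
    (hf : IsAsympQuasiHomogeneous α k f) (hC : C.Admissible α k)
    (hg : ∀ x ∈ C.domain, polyField g x = C.desing α k f x) (hp : p ∈ C.horizon)
    (hP : IsStableParameterization g p lam ξ a) {θ : Fin m → ℝ} (hθ : θ ∈ polydisc m)
    {y₀ : Fin n → ℝ} (hy₀ : y₀ ∈ C.source) (hθy : powerSeries a θ = C.T α y₀) :
    tmax f y₀ = ENNReal.ofReal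
      (∫ τ in Ioi (0 : ℝ), C.timeFactor k (powerSeries a (linFlow lam τ θ))) := by
  obtain ⟨hpos, y, hy0, hsol, -, hlim⟩ := exists_blowUp_solution hα hk hf hC hg hp hP hθ hy₀ hθy
  rw [← hy0]
  exact hsol.tmax_eq (hf.1.of_le (by exact_mod_cast le_top)) hpos hlim

/-- Along the manifold, the blow-up time is locally given by an analytic function. -/
theorem exists_analyticAt_tmax (hα : ∀ i, 1 ≤ α i) (hk : 1 ≤ k)
    (hf : IsAsympQuasiHomogeneous α k f) (hC : C.Admissible α k)
    (hg : ∀ x ∈ C.domain, polyField g x = C.desing α k f x) (hp : p ∈ C.horizon)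
    (hP : IsStableParameterization g p lam ξ a) {y₀ : Fin n → ℝ}
    (hy₀ : y₀ ∈ C.preimage α (powerSeries a '' openPolydisc m)) :
    ∃ F : (Fin n → ℝ) → ℝ, AnalyticAt ℝ F y₀ ∧
      ∀ᶠ y in 𝓝[C.preimage α (powerSeries a '' polydisc m)] y₀, (tmax f y).toReal = F y := by
  obtain ⟨hsrc, θ₀, hθ₀, hθy⟩ := hy₀
  obtain ⟨c, hc, hint⟩ := exists_blowUpTime_expansion hk hC hp hP
  obtain ⟨R, hR, hRP⟩ := exists_analytic_leftInverse (hP.analyticAt hθ₀) (hP.fderiv_injective hθ₀)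
  have hT := Compactification.analyticAt_T hC hsrc
  have hΦ := analyticAt_tsum_monomial hc hθ₀
  have hR0 : R (C.T α y₀) = θ₀ := by rw [← hθy]; exact hRP.self_of_nhds
  have hRT : AnalyticAt ℝ (fun y => R (C.T α y)) y₀ := by
    rw [hθy] at hR
    exact hR.fun_comp hT
  refine ⟨fun y => ∑' γ, (∏ i, R (C.T α y) i ^ γ i) • c γ, ?_, ?_⟩
  · rw [← hR0] at hΦ
    exact AnalyticAt.fun_comp (f := fun y => R (C.T α y)) hΦ hRT
  -- The left inverse is only local, so points of `V` near `y₀` must be known to have parameters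
  -- near `θ₀`.
  · have hnear := hP.eventually_mem_of_powerSeries_eq (openPolydisc_subset m hθ₀) hRP
    rw [hθy] at hnear
    filter_upwards [(hT.continuousAt.eventually hnear).filter_mono nhdsWithin_le_nhds,
      self_mem_nhdsWithin] with y hy hyV
    obtain ⟨hysrc, θ, hθ, hθe⟩ := hyV
    have hRθ : R (powerSeries a θ) = θ := hy θ hθ hθe
    obtain ⟨hpos, -⟩ := exists_blowUp_solution hα hk hf hC hg hp hP hθ hysrc hθe
    rw [tmax_eq_integral hα hk hf hC hg hp hP hθ hysrc hθe, ENNReal.toReal_ofReal hpos.le,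
      (hint θ hθ).2, ← hθe, hRθ]

/-- Pulling a neighbourhood back along the continuous `Tinv` shows that `W` is a neighbourhood of `T
y₀`, and the backward flow argument applies. -/
theorem interior_preimage_subset (hα : ∀ i, 1 ≤ α i) (hC : C.Admissible α k)
    (hP : IsStableParameterization g p lam ξ a) :
    interior (C.preimage α (powerSeries a '' polydisc m)) ⊆
      C.preimage α (powerSeries a '' openPolydisc m) := by
  intro y₀ hy₀
  obtain ⟨hsrc, θ₀, hθ₀, hθy⟩ := interior_subset hy₀
  refine ⟨hsrc, θ₀, hP.mem_openPolydisc_of_image_mem_nhds hθ₀ ?_, hθy⟩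
  have hdom := Compactification.T_mem_domain hα hC hsrc
  have hcont := Compactification.continuousAt_Tinv hC hdom
  have hnhds : C.preimage α (powerSeries a '' polydisc m) ∈ 𝓝 (C.Tinv α (C.T α y₀)) := by
    rw [Compactification.Tinv_T hα hC hsrc]
    exact mem_interior_iff_mem_nhds.1 hy₀
  rw [hθy]
  filter_upwards [hcont.preimage_mem_nhds hnhds,
    (Compactification.isOpen_domain hC).mem_nhds hdom] with x hx hxd
  have := hx.2
  rwa [Compactification.T_Tinv hα hC hxd] at this

end

end BlowUp

/-! ### The main theorem -/

theorem mainTheorem1 {n m : ℕ} (α : Fin n → ℕ) (k : ℕ) (hα : ∀ i, 1 ≤ α i) (hk : 1 ≤ k)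
    (f : (Fin n → ℝ) → (Fin n → ℝ)) (hf : BlowUp.IsAsympQuasiHomogeneous α k f)
    (C : BlowUp.Compactification n) (hC : C.Admissible α k)
    (g : Fin n → MvPolynomial (Fin n) ℝ)
    (hg : ∀ x ∈ C.domain, BlowUp.polyField g x = C.desing α k f x)
    (p : Fin n → ℝ) (hp : p ∈ C.horizon)
    (lam : Fin m → ℝ) (ξ : Fin m → Fin n → ℝ) (a : (Fin m → ℕ) → (Fin n → ℝ))
    (hP : BlowUp.IsStableParameterization g p lam ξ a)
    (W V V' : Set (Fin n → ℝ))
    (hW : W = BlowUp.powerSeries a '' BlowUp.polydisc m)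
    (hV : V = C.preimage α W)
    (hV' : V' = C.preimage α (BlowUp.powerSeries a '' BlowUp.openPolydisc m)) :
    -- every solution starting on `T⁻¹(W)` blows up, at the time given by the integral formula
    (∀ y₀ ∈ V, 0 < BlowUp.tmax f y₀ ∧ BlowUp.tmax f y₀ < ⊤ ∧
      ∀ θ ∈ BlowUp.polydisc m, BlowUp.powerSeries a θ = C.T α y₀ →
        IntegrableOn
          (fun τ : ℝ => C.timeFactor k (BlowUp.powerSeries a (BlowUp.linFlow lam τ θ))) (Ioi 0) ∧
        (BlowUp.tmax f y₀).toReal =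
          ∫ τ in Ioi (0 : ℝ),
            C.timeFactor k (BlowUp.powerSeries a (BlowUp.linFlow lam τ θ))) ∧
    -- the blow-up time is real analytic along `T⁻¹(W)` at every point of its manifold interior
    (∀ y₀ ∈ V', ∃ F : (Fin n → ℝ) → ℝ, AnalyticAt ℝ F y₀ ∧
      ∀ᶠ y in 𝓝[V] y₀, (BlowUp.tmax f y).toReal = F y) ∧
    -- and real analytic in `ℝⁿ` at every point of the topological interior of `T⁻¹(W)`
    (∀ y₀ ∈ interior V, AnalyticAt ℝ (fun y => (BlowUp.tmax f y).toReal) y₀) ∧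
    -- the blow-up time tends to zero as the initial point goes to infinity along a solution
    (∀ y₀ ∈ V, ∃ y : ℝ → Fin n → ℝ, y 0 = y₀ ∧
      BlowUp.IsSolutionOn f y (BlowUp.tmax f y₀).toReal ∧
      (∀ t ∈ Ico 0 (BlowUp.tmax f y₀).toReal, y t ∈ V) ∧
      Tendsto y (𝓝[<] (BlowUp.tmax f y₀).toReal) (Bornology.cobounded (Fin n → ℝ)) ∧
      Tendsto (fun t => BlowUp.tmax f (y t)) (𝓝[<] (BlowUp.tmax f y₀).toReal) (𝓝 0)) := by
  subst hW hV hV'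
  refine ⟨?_, fun y₀ hy₀ => BlowUp.exists_analyticAt_tmax hα hk hf hC hg hp hP hy₀, ?_, ?_⟩
  · rintro y₀ ⟨hsrc, θ₀, hθ₀, hθ₀y⟩
    have htm : ∀ θ ∈ BlowUp.polydisc m, BlowUp.powerSeries a θ = C.T α y₀ →
        0 < (∫ τ in Ioi (0 : ℝ), C.timeFactor k (BlowUp.powerSeries a (BlowUp.linFlow lam τ θ))) ∧
        BlowUp.tmax f y₀ = ENNReal.ofReal (∫ τ in Ioi (0 : ℝ),
          C.timeFactor k (BlowUp.powerSeries a (BlowUp.linFlow lam τ θ))) := fun θ hθ h =>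
      ⟨(BlowUp.exists_blowUp_solution hα hk hf hC hg hp hP hθ hsrc h).1,
        BlowUp.tmax_eq_integral hα hk hf hC hg hp hP hθ hsrc h⟩
    obtain ⟨hpos, heq⟩ := htm θ₀ hθ₀ hθ₀y
    refine ⟨heq ▸ ENNReal.ofReal_pos.2 hpos, heq ▸ ENNReal.ofReal_lt_top, fun θ hθ h => ?_⟩
    obtain ⟨hpos', heq'⟩ := htm θ hθ h
    obtain ⟨c, -, hc⟩ := BlowUp.exists_blowUpTime_expansion hk hC hp hP
    exact ⟨(hc θ hθ).1, by rw [heq', ENNReal.toReal_ofReal hpos'.le]⟩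
  · intro y₀ hy₀
    obtain ⟨F, hF, hev⟩ := BlowUp.exists_analyticAt_tmax hα hk hf hC hg hp hP
      (BlowUp.interior_preimage_subset hα hC hP hy₀)
    rw [nhdsWithin_eq_nhds.2 (mem_interior_iff_mem_nhds.1 hy₀)] at hev
    exact hF.congr (hev.mono fun y hy => hy.symm)
  · rintro y₀ ⟨hsrc, θ, hθ, hθy⟩
    obtain ⟨hpos, y, hy0, hsol, hmem, hlim⟩ :=
      BlowUp.exists_blowUp_solution hα hk hf hC hg hp hP hθ hsrc hθy
    have htm := BlowUp.tmax_eq_integral hα hk hf hC hg hp hP hθ hsrc hθy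
    set T := ∫ τ in Ioi (0 : ℝ), C.timeFactor k (BlowUp.powerSeries a (BlowUp.linFlow lam τ θ))
    rw [htm, ENNReal.toReal_ofReal hpos.le]
    refine ⟨y, hy0, hsol, hmem, hlim, ?_⟩
    have hT : Tendsto (fun t => ENNReal.ofReal (T - t)) (𝓝[<] T) (𝓝 0) := by
      have : Continuous fun t => ENNReal.ofReal (T - t) :=
        ENNReal.continuous_ofReal.comp (continuous_const.sub continuous_id)
      have h := this.tendsto T
      rw [sub_self, ENNReal.ofReal_zero] at h
      exact h.mono_left nhdsWithin_le_nhds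
    refine hT.congr' ?_
    filter_upwards [Ioo_mem_nhdsLT hpos] with t ht
    exact (hsol.tmax_eq_sub (hf.1.of_le (by exact_mod_cast le_top)) hlim ⟨ht.1.le, ht.2⟩).symm
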